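/- **Theorem 2.3.** Let $\psi:\mathbb{R}^n\to\mathbb{R}^l$ be a linear map. For a polytope $P\subseteq\mathbb{R}^n$ (the convex hull of a finite nonempty set) the fiber polytope is the Minkowski integral $$\Sigma_\psi(P)=\int_{\psi(P)}\bigl(\psi^{-1}(x)\cap P\bigr)\,dx=\Bigl\{\int_{\psi(P)}\gamma(x)\,dx \;:\; \gamma:\psi(P)\to P \text{ integrable},\ \psi\circ\gamma=\mathrm{id}\Bigr\},$$ where $dx$ is Lebesgue measure on $\mathbb{R}^l$; it is again a polytope. Let $r=l+1$ and let $P_1,\dots,P_r\subseteq\mathbb{R}^n$ be any polytopes. The mixed fiber polytope $\Sigma_\psi(P_1,\dots,P_r)$ is the coefficient $M_{1\cdots1}$ of $\lambda_1\cdots\lambda_r$ in an expansion $$\Sigma_\psi(\lambda_1P_1+\dots+\lambda_rP_r)=\sum_{i_1+\dots+i_r=l+1}\lambda_1^{i_1}\cdots\lambda_r^{i_r}\,M_{i_1\cdots i_r}\qquad(\lambda_1,\dots,\lambda_r>0)$$ whose coefficients $M_{i_1\cdots i_r}$ are polytopes (sums are Minkowski sums). This polytope exists and is uniquely determined, and in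 the group of virtual polytopes, that is, the group of formal differences of polytopes in $\mathbb{R}^n$ under Minkowski addition, $$\Sigma_\psi(P_1,\dots,P_r)=\sum_{k=1}^{r}(-1)^{r+k}\sum_{1\le i_1<\dots<i_k\le r}\Sigma_\psi(P_{i_1}+\dots+P_{i_k}).$$ -/

import Mathlib

open scoped Pointwise
open MeasureTheory

namespace FiberPoly

/-- A polytope: the convex hull of a finite nonempty set of points. -/
def IsPolytope {E : Type*} [AddCommGroup E] [Module ℝ E] (S : Set E) : Prop :=
  ∃ V : Finset E, V.Nonempty ∧ S = convexHull ℝ (V : Set E)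

theorem isPolytope_zero {E : Type*} [AddCommGroup E] [Module ℝ E] :
    IsPolytope (0 : Set E) :=
  ⟨{0}, by simp, by simp [Set.singleton_zero]⟩

theorem IsPolytope.add {E : Type*} [AddCommGroup E] [Module ℝ E] {S T : Set E}
    (hS : IsPolytope S) (hT : IsPolytope T) : IsPolytope (S + T) := by
  classical
  obtain ⟨V, hV, rfl⟩ := hS
  obtain ⟨W, hW, rfl⟩ := hT
  exact ⟨V + W, hV.add hW, by rw [Finset.coe_add, convexHull_add]⟩

theorem IsPolytope.smul {E : Type*} [AddCommGroup E] [Module ℝ E] {S : Set E}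
    (c : ℝ) (hS : IsPolytope S) : IsPolytope (c • S) := by
  classical
  obtain ⟨V, hV, rfl⟩ := hS
  exact ⟨c • V, hV.smul_finset, by rw [Finset.coe_smul_finset, convexHull_smul]⟩

/-- The semigroup of polytopes in `ℝⁿ` under Minkowski addition (the neutral element is `{0}`). -/
def polytopes (n : ℕ) : AddSubmonoid (Set (EuclideanSpace ℝ (Fin n))) where
  carrier := {S | IsPolytope S}
  zero_mem' := isPolytope_zero
  add_mem' := IsPolytope.add

/-- The type of polytopes in `ℝⁿ`; its addition is the Minkowski sum. -/
abbrev Polytope (n : ℕ) : Type := polytopes n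

/-- Dilation `c • P = {c • x | x ∈ P}`. -/
instance (n : ℕ) : SMul ℝ (Polytope n) := ⟨fun c P => ⟨c • P.1, P.2.smul c⟩⟩

/-- The group of virtual polytopes: formal differences of polytopes. -/
abbrev VirtualPolytope (n : ℕ) : Type := Algebra.GrothendieckAddGroup (Polytope n)

/-- A polytope regarded as a virtual polytope. -/
noncomputable def Polytope.toVirtual {n : ℕ} (P : Polytope n) : VirtualPolytope n :=
  Algebra.GrothendieckAddGroup.of P

/-- The Minkowski integral `∫_Q (ψ⁻¹(x) ∩ P) dx` over `Q = ψ(P)`, with respect to Lebesgue measure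
of `ℝˡ`: the set of the integrals of all integrable sections `γ : Q → P` of `ψ`. -/
def fiberIntegral {n l : ℕ} (ψ : EuclideanSpace ℝ (Fin n) →ₗ[ℝ] EuclideanSpace ℝ (Fin l))
    (P : Set (EuclideanSpace ℝ (Fin n))) : Set (EuclideanSpace ℝ (Fin n)) :=
  {y | ∃ γ : EuclideanSpace ℝ (Fin l) → EuclideanSpace ℝ (Fin n),
      IntegrableOn γ (ψ '' P) volume ∧ (∀ x ∈ ψ '' P, γ x ∈ P ∧ ψ (γ x) = x) ∧
      y = ∫ x in ψ '' P, γ x}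

/-! ### The Minkowski integral of a polytope is a polytope -/

section aux

theorem exists_pos_add_mul_nonneg {ι : Type*} [Finite ι] (w d : ι → ℝ) (hw : ∀ i, 0 ≤ w i)
    (hd : ∀ i, w i = 0 → 0 ≤ d i) : ∃ ε : ℝ, 0 < ε ∧ ∀ i, 0 ≤ w i + ε * d i := by
  have h : ∀ᶠ ε in nhdsWithin (0 : ℝ) (Set.Ioi 0), ∀ i, 0 ≤ w i + ε * d i := by
    rw [Filter.eventually_all]
    intro i
    rcases (hw i).eq_or_lt with h0 | h0
    · filter_upwards [self_mem_nhdsWithin] with ε hε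
      have := hd i h0.symm
      have hε' : (0 : ℝ) < ε := hε
      have := mul_nonneg hε'.le this
      linarith
    · have hc : Filter.Tendsto (fun ε : ℝ => w i + ε * d i) (nhdsWithin 0 (Set.Ioi 0))
          (nhds (w i + 0 * d i)) :=
        ((by fun_prop : Continuous fun ε : ℝ => w i + ε * d i).tendsto 0).mono_left
          nhdsWithin_le_nhds
      rw [zero_mul, add_zero] at hc
      exact (hc.eventually (lt_mem_nhds h0)).mono fun ε h => h.le
  obtain ⟨ε, h1, h2⟩ := (h.and self_mem_nhdsWithin).exists
  exact ⟨ε, h2, h1⟩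

/-- A nonzero direction of total mass zero can be followed until the support gets smaller. -/
theorem exists_support_reduce {ι : Type*} [Fintype ι] (w d : ι → ℝ) (hw : ∀ i, 0 ≤ w i)
    (hd : ∀ i, w i = 0 → d i = 0) (hs : ∑ i, d i = 0) (h0 : d ≠ 0) :
    ∃ t : ℝ, (∀ i, 0 ≤ w i + t * d i) ∧
      (Finset.univ.filter fun i => w i + t * d i ≠ 0) ⊂ Finset.univ.filter fun i => w i ≠ 0 := by
  classical
  have hneg : (Finset.univ.filter fun i => d i < 0).Nonempty := by
    by_contra hne
    rw [Finset.not_nonempty_iff_eq_empty, Finset.filter_eq_empty_iff] at hne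
    have hnn : ∀ i ∈ Finset.univ, 0 ≤ d i := fun i hi => not_lt.1 (hne hi)
    exact h0 (funext fun i => (Finset.sum_eq_zero_iff_of_nonneg hnn).1 hs i (Finset.mem_univ i))
  obtain ⟨j, hj, hmin⟩ := Finset.exists_min_image _ (fun i => w i / (-d i)) hneg
  rw [Finset.mem_filter] at hj
  have hjd := hj.2
  refine ⟨w j / (-d j), fun i => ?_, ?_⟩
  · rcases lt_or_ge (d i) 0 with hi | hi
    · have := hmin i (Finset.mem_filter.2 ⟨Finset.mem_univ i, hi⟩)
      rw [le_div_iff₀ (by linarith)] at this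
      linarith
    · have : 0 ≤ w j / (-d j) := div_nonneg (hw j) (by linarith)
      have := mul_nonneg this hi
      linarith [hw i]
  · rw [Finset.ssubset_iff_of_subset]
    · refine ⟨j, ?_, ?_⟩
      · rw [Finset.mem_filter]
        exact ⟨Finset.mem_univ j, fun h => hjd.ne (hd j h)⟩
      · rw [Finset.mem_filter]
        rintro ⟨-, h⟩
        apply h
        have := hjd.ne
        rw [div_neg, neg_mul, div_mul_cancel₀ _ this, add_neg_cancel]
    · intro i
      simp only [Finset.mem_filter, Finset.mem_univ, true_and]
      intro h h'
      apply h
      rw [h', hd i h', mul_zero, add_zero]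

variable {ι : Type*} [Fintype ι] {W : Type*} [AddCommGroup W] [Module ℝ W]

/-- A basic optimal solution stays optimal, for the same basis, wherever it is feasible. -/
theorem exists_basic_optimal (B : (ι → ℝ) →ₗ[ℝ] W) (hB : ∀ d, B d = 0 → ∑ i, d i = 0)
    (c : (ι → ℝ) →ₗ[ℝ] ℝ) (p : ι → ℝ) (hp : p ∈ stdSimplex ℝ ι) :
    ∃ w ∈ stdSimplex ℝ ι, B w = B p ∧
      (∀ d : ι → ℝ, (∀ i, w i = 0 → d i = 0) → B d = 0 → d = 0) ∧
      ∀ p' ∈ stdSimplex ℝ ι, (∀ i, w i = 0 → p' i = 0) →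
        ∀ q ∈ stdSimplex ℝ ι, B q = B p' → c q ≤ c p' := by
  classical
  have hmass : ∀ (w d : ι → ℝ) (t : ℝ), w ∈ stdSimplex ℝ ι → ∑ i, d i = 0 →
      (∀ i, 0 ≤ w i + t * d i) → w + t • d ∈ stdSimplex ℝ ι := by
    intro w d t hw hd h
    refine ⟨h, ?_⟩
    have : ∑ i, (w i + t * d i) = 1 := by
      rw [Finset.sum_add_distrib, ← Finset.mul_sum, hd, hw.2, mul_zero, add_zero]
    simpa using this
  let K : Set (ι → ℝ) := stdSimplex ℝ ι ∩ {w | B w = B p}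
  have hK : IsCompact K := by
    apply (isCompact_stdSimplex ℝ ι).inter_right
    have : {w | B w = B p} = (fun w => w - p) ⁻¹' (LinearMap.ker B : Set (ι → ℝ)) := by
      ext w
      simp [sub_eq_zero]
    rw [this]
    exact (Submodule.closed_of_finiteDimensional _).preimage (by fun_prop)
  obtain ⟨m, hm, hmax⟩ := hK.exists_isMaxOn ⟨p, hp, rfl⟩
    (LinearMap.continuous_of_finiteDimensional c).continuousOn
  let O : Set (ι → ℝ) := {w | w ∈ stdSimplex ℝ ι ∧ B w = B p ∧
    ∀ q ∈ stdSimplex ℝ ι, B q = B p → c q ≤ c w}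
  have hO : O.Nonempty := ⟨m, hm.1, hm.2, fun q h1 h2 => hmax ⟨h1, h2⟩⟩
  let supp : (ι → ℝ) → Finset ι := fun w => Finset.univ.filter fun i => w i ≠ 0
  let w := Function.argminOn (fun w => (supp w).card) O hO
  have hwO : w ∈ O := Function.argminOn_mem _ _ _
  have hwmin : ∀ v ∈ O, (supp w).card ≤ (supp v).card := fun v hv =>
    Function.argminOn_le (fun w => (supp w).card) O hv
  clear_value w
  refine ⟨w, hwO.1, hwO.2.1, ?_, ?_⟩
  · intro d hd hBd
    by_contra hne
    have hsum := hB d hBd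
    have step : ∀ t : ℝ, (∀ i, 0 ≤ w i + t * d i) → c (w + t • d) ≤ c w := by
      intro t ht
      apply hwO.2.2 _ (hmass w d t hwO.1 hsum ht)
      rw [map_add, map_smul, hBd, smul_zero, add_zero, hwO.2.1]
    have hcd : c d = 0 := by
      obtain ⟨ε, hε, h1⟩ := exists_pos_add_mul_nonneg w d hwO.1.1 fun i hi => (hd i hi).ge
      obtain ⟨δ, hδ, h2⟩ := exists_pos_add_mul_nonneg w (-d) hwO.1.1
        fun i hi => by simp [hd i hi]
      have a1 := step ε h1
      have a2 := step (-δ) fun i => by simpa using h2 i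
      simp only [map_add, map_smul, smul_eq_mul] at a1 a2
      have a1' : ε * c d ≤ 0 := by linarith
      have a2' : 0 ≤ δ * c d := by linarith
      exact le_antisymm (nonpos_of_mul_nonpos_right a1' hε) (nonneg_of_mul_nonneg_right a2' hδ)
    obtain ⟨t, ht, hlt⟩ := exists_support_reduce w d hwO.1.1 hd hsum hne
    have hmem : w + t • d ∈ O := by
      refine ⟨hmass w d t hwO.1 hsum ht, ?_, ?_⟩
      · rw [map_add, map_smul, hBd, smul_zero, add_zero, hwO.2.1]
      · rw [map_add, map_smul, hcd, smul_zero, add_zero]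
        exact hwO.2.2
    exact absurd (hwmin _ hmem) (not_le.2 (Finset.card_lt_card hlt))
  · intro p' hp' hsup q hq hBq
    by_contra! hlt
    have hBd : B (q - p') = 0 := by rw [map_sub, hBq, sub_self]
    obtain ⟨ε, hε, h1⟩ := exists_pos_add_mul_nonneg w (q - p') hwO.1.1
      fun i hi => by simpa [hsup i hi] using hq.1 i
    have := hwO.2.2 _ (hmass w (q - p') ε hwO.1 (hB _ hBd) h1) (by
      rw [map_add, map_smul, hBd, smul_zero, add_zero, hwO.2.1])
    rw [map_add, map_smul, smul_eq_mul, map_sub] at this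
    have := mul_pos hε (sub_pos.2 hlt)
    linarith

/-- Gluing finitely many measurable functions given on measurable pieces. -/
theorem exists_measurable_glue {κ X Y : Type*} [MeasurableSpace X] [MeasurableSpace Y]
    [Inhabited Y] (R : κ → Set X) (g : κ → X → Y) (hR : ∀ k, MeasurableSet (R k))
    (hg : ∀ k, Measurable (g k)) (T : Finset κ) :
    ∃ γ : X → Y, Measurable γ ∧ ∀ x, (∃ k ∈ T, x ∈ R k) → ∃ k ∈ T, x ∈ R k ∧ γ x = g k x := by
  classical
  induction T using Finset.induction_on with
  | empty => exact ⟨fun _ => default, measurable_const, by simp⟩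
  | insert k T hk ih =>
    obtain ⟨γ, hγ, h⟩ := ih
    refine ⟨(R k).piecewise (g k) γ, (hg k).piecewise (hR k) hγ, fun x hx => ?_⟩
    by_cases hxk : x ∈ R k
    · exact ⟨k, Finset.mem_insert_self _ _, hxk, by simp [hxk]⟩
    · obtain ⟨j, hj, hxj⟩ := hx
      rcases Finset.mem_insert.1 hj with rfl | hj
      · exact absurd hxj hxk
      · obtain ⟨i, hi, hxi, e⟩ := h x ⟨j, hj, hxj⟩
        exact ⟨i, Finset.mem_insert_of_mem hi, hxi, by simp [hxk, e]⟩

end aux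

theorem isPolytope_fiberIntegral {n l : ℕ}
    (ψ : EuclideanSpace ℝ (Fin n) →ₗ[ℝ] EuclideanSpace ℝ (Fin l))
    {P : Set (EuclideanSpace ℝ (Fin n))} (hP : IsPolytope P) :
    IsPolytope (fiberIntegral ψ P) := by
  classical
  obtain ⟨V, hV, rfl⟩ := hP
  set P := convexHull ℝ (V : Set (EuclideanSpace ℝ (Fin n))) with hPdef
  set Q := ψ '' P with hQdef
  have hPc : IsCompact P := V.finite_toSet.isCompact_convexHull ℝ
  have hψ : Continuous ψ := LinearMap.continuous_of_finiteDimensional ψ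
  have hQc : IsCompact Q := hPc.image hψ
  -- weights
  let A : (V → ℝ) →ₗ[ℝ] EuclideanSpace ℝ (Fin n) := Fintype.linearCombination ℝ (fun v : V => v.1)
  let B : (V → ℝ) →ₗ[ℝ] EuclideanSpace ℝ (Fin l) × ℝ :=
    (ψ ∘ₗ A).prod (∑ v : V, LinearMap.proj v)
  have hPA : P = A '' stdSimplex ℝ V := by
    rw [hPdef, V.finite_toSet.convexHull_eq_image]
    have e : ∀ w, A w = ∑ v, w v • (v : EuclideanSpace ℝ (Fin n)) := fun w =>
      Fintype.linearCombination_apply ℝ _ w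
    simp only [Set.image, e]
    congr!
    simp only [LinearMap.sum_apply, LinearMap.smulRight_apply, LinearMap.proj_apply]
    congr!
  have hBs : ∀ w, (B w).2 = ∑ v, w v := fun w => by simp [B]
  have hB1 : ∀ w, (B w).1 = ψ (A w) := fun w => rfl
  have hB0 : ∀ d, B d = 0 → ∑ i, d i = 0 := fun d hd => by rw [← hBs, hd]; rfl
  have hBw : ∀ w ∈ stdSimplex ℝ V, B w = (ψ (A w), 1) := fun w hw =>
    Prod.ext rfl ((hBs w).trans hw.2)
  let good : Finset V → Prop := fun τ => ∀ d : V → ℝ, (∀ i ∉ τ, d i = 0) → B d = 0 → d = 0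
  have hinv : ∀ τ : Finset V, ∃ g : (EuclideanSpace ℝ (Fin l) × ℝ) →ₗ[ℝ] (V → ℝ),
      (∀ z, ∀ i ∉ τ, g z i = 0) ∧
      (good τ → ∀ w : V → ℝ, (∀ i ∉ τ, w i = 0) → g (B w) = w) := by
    intro τ
    by_cases hτ : good τ
    · let S : Submodule ℝ (V → ℝ) :=
        { carrier := {w | ∀ i ∉ τ, w i = 0}
          zero_mem' := fun _ _ => rfl
          add_mem' := fun {a b} ha hb i hi => by simp [ha i hi, hb i hi]
          smul_mem' := fun c a ha i hi => by simp [ha i hi] }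
      have hker : LinearMap.ker (B ∘ₗ S.subtype) = ⊥ := by
        rw [LinearMap.ker_eq_bot']
        intro d hd
        exact Subtype.ext (hτ d.1 d.2 hd)
      obtain ⟨g, hg⟩ := LinearMap.exists_leftInverse_of_injective _ hker
      refine ⟨S.subtype ∘ₗ g, fun z => (g z).2, fun _ w hw => ?_⟩
      have := LinearMap.congr_fun hg ⟨w, hw⟩
      exact congrArg Subtype.val this
    · exact ⟨0, fun _ _ _ => rfl, fun h => absurd h hτ⟩
  choose g hg0 hg using hinv
  let s : Finset V → EuclideanSpace ℝ (Fin l) → (V → ℝ) := fun τ x => g τ (x, 1)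
  have hsc : ∀ τ, Continuous (s τ) := fun τ =>
    (LinearMap.continuous_of_finiteDimensional (g τ)).comp (by fun_prop)
  have hAc : Continuous A := LinearMap.continuous_of_finiteDimensional A
  let R : Finset V → Set (EuclideanSpace ℝ (Fin l)) := fun τ =>
    s τ ⁻¹' stdSimplex ℝ V ∩ {x | ψ (A (s τ x)) = x}
  have hR : ∀ τ, MeasurableSet (R τ) := fun τ =>
    (((isClosed_stdSimplex ℝ V).preimage (hsc τ)).inter
      (isClosed_eq (hψ.comp (hAc.comp (hsc τ))) continuous_id)).measurableSet
  have hglue := exists_measurable_glue R (fun τ x => A (s τ x)) hR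
    (fun τ => (hAc.comp (hsc τ)).measurable)
  choose γ hγm hγ using hglue
  -- finitely many candidates for the vertices
  let C : Finset (Finset (Finset V)) :=
    Finset.univ.filter fun T => ∀ x ∈ Q, ∃ τ ∈ T, x ∈ R τ
  have hsec : ∀ T ∈ C, ∀ x ∈ Q, γ T x ∈ P ∧ ψ (γ T x) = x := by
    intro T hT x hx
    obtain ⟨τ, -, hxτ, e⟩ := hγ T x ((Finset.mem_filter.1 hT).2 x hx)
    rw [e, hPA]
    exact ⟨⟨_, hxτ.1, rfl⟩, hxτ.2⟩
  have hint : ∀ T ∈ C, IntegrableOn (γ T) Q volume := by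
    intro T hT
    obtain ⟨M, hM⟩ := hPc.isBounded.exists_norm_le
    refine Measure.integrableOn_of_bounded (M := M) hQc.measure_lt_top.ne
      (hγm T).aestronglyMeasurable ?_
    rw [ae_restrict_iff' hQc.measurableSet]
    exact Filter.Eventually.of_forall fun x hx => hM _ (hsec T hT x hx).1
  have hopt : ∀ u : EuclideanSpace ℝ (Fin n) →ₗ[ℝ] ℝ, ∃ T ∈ C, ∀ x ∈ Q, ∀ y ∈ P, ψ y = x →
      u y ≤ u (γ T x) := by
    intro u
    let T : Finset (Finset V) := Finset.univ.filter fun τ =>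
      ∀ x ∈ R τ, ∀ y ∈ P, ψ y = x → u y ≤ u (A (s τ x))
    have hTC : ∀ x ∈ Q, ∃ τ ∈ T, x ∈ R τ := by
      intro x hx
      obtain ⟨y, hy, rfl⟩ := hx
      rw [hPA] at hy
      obtain ⟨p, hp, rfl⟩ := hy
      obtain ⟨w, hw, hwp, hgood, hbest⟩ := exists_basic_optimal B hB0 (u ∘ₗ A) p hp
      let τ : Finset V := Finset.univ.filter fun i => w i ≠ 0
      have hτ : ∀ i, i ∉ τ ↔ w i = 0 := fun i => by simp [τ]
      have hgd : good τ := fun d hd h => hgood d (fun i hi => hd i ((hτ i).2 hi)) h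
      refine ⟨τ, Finset.mem_filter.2 ⟨Finset.mem_univ _, ?_⟩, ?_⟩
      · intro x hx y hy hyx
        rw [hPA] at hy
        obtain ⟨q, hq, rfl⟩ := hy
        refine hbest _ hx.1 (fun i hi => hg0 τ _ i ((hτ i).2 hi)) q hq ?_
        rw [hBw q hq, hBw _ hx.1, hyx, hx.2]
      · have e : s τ (ψ (A p)) = w := by
          have : ((ψ (A p), 1) : EuclideanSpace ℝ (Fin l) × ℝ) = B w := by
            rw [hwp, hBw p hp]
          simp only [s]
          rw [this]
          exact hg τ hgd w fun i hi => (hτ i).1 hi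
        refine ⟨?_, ?_⟩
        · rw [Set.mem_preimage, e]
          exact hw
        · change ψ (A (s τ (ψ (A p)))) = ψ (A p)
          rw [e]
          exact congrArg Prod.fst hwp
    refine ⟨T, Finset.mem_filter.2 ⟨Finset.mem_univ _, hTC⟩, fun x hx y hy hyx => ?_⟩
    obtain ⟨τ, hτ, hxτ, e⟩ := hγ T x (hTC x hx)
    rw [e]
    exact (Finset.mem_filter.1 hτ).2 x hxτ y hy hyx
  -- convexity
  have hconv : Convex ℝ (fiberIntegral ψ P) := by
    rintro _ ⟨γ₁, i₁, s₁, rfl⟩ _ ⟨γ₂, i₂, s₂, rfl⟩ a b ha hb hab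
    refine ⟨fun x => a • γ₁ x + b • γ₂ x, (i₁.smul a).add (i₂.smul b), fun x hx => ⟨?_, ?_⟩, ?_⟩
    · exact convex_convexHull ℝ _ (s₁ x hx).1 (s₂ x hx).1 ha hb hab
    · rw [map_add, map_smul, map_smul, (s₁ x hx).2, (s₂ x hx).2, ← add_smul, hab, one_smul]
    · exact ((integral_add (i₁.smul a) (i₂.smul b)).trans
        (congrArg₂ _ (integral_smul a γ₁) (integral_smul b γ₂))).symm
  refine ⟨C.image fun T => ∫ x in Q, γ T x, ?_, ?_⟩
  · obtain ⟨T, hT, -⟩ := hopt 0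
    exact ⟨_, Finset.mem_image_of_mem _ hT⟩
  · apply Set.Subset.antisymm
    · rintro _ ⟨δ, hδi, hδ, rfl⟩
      by_contra hnot
      obtain ⟨f, c, hf1, hf2⟩ := geometric_hahn_banach_closed_point (convex_convexHull ℝ _)
        ((Finset.finite_toSet _).isCompact_convexHull ℝ).isClosed hnot
      obtain ⟨T, hT, hmax⟩ := hopt f
      have h1 := hf1 _ (subset_convexHull ℝ _ (Finset.mem_coe.2
        (Finset.mem_image_of_mem (fun T => ∫ x in Q, γ T x) hT)))
      rw [← f.integral_comp_comm (hint T hT)] at h1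
      rw [← f.integral_comp_comm hδi] at hf2
      have h2 : ∫ x in Q, f (δ x) ≤ ∫ x in Q, f (γ T x) :=
        setIntegral_mono_on (f.integrable_comp hδi) (f.integrable_comp (hint T hT))
          hQc.measurableSet fun x hx => hmax x hx _ (hδ x hx).1 (hδ x hx).2
      linarith
    · apply convexHull_min _ hconv
      intro y hy
      obtain ⟨T, hT, rfl⟩ := Finset.mem_image.1 (Finset.mem_coe.1 hy)
      exact ⟨γ T, hint T hT, hsec T hT, rfl⟩

/-- The fiber polytope `Σ_ψ(P)`. -/
def fiberPolytope {n l : ℕ} (ψ : EuclideanSpace ℝ (Fin n) →ₗ[ℝ] EuclideanSpace ℝ (Fin l))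
    (P : Polytope n) : Polytope n :=
  ⟨fiberIntegral ψ P.1, isPolytope_fiberIntegral ψ P.2⟩

/-- The family of polytopes `M`, indexed by exponent vectors, is a family of coefficients of
`Σ_ψ(λ₁P₁ + ⋯ + λᵣPᵣ)` as a homogeneous polynomial of degree `l + 1` in `λ₁, …, λᵣ > 0`. The sum
runs over all `i : Fin r → ℕ` with `∑ j, i j = l + 1`; only these values of `M` matter. -/
def IsFiberExpansion {n l r : ℕ} (ψ : EuclideanSpace ℝ (Fin n) →ₗ[ℝ] EuclideanSpace ℝ (Fin l))
    (P : Fin r → Polytope n) (M : (Fin r → ℕ) → Polytope n) : Prop :=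
  ∀ c : Fin r → ℝ, (∀ j, 0 < c j) →
    fiberPolytope ψ (∑ j, c j • P j) =
      ∑ i ∈ Finset.piAntidiag Finset.univ (l + 1), (∏ j, c j ^ i j) • M i

/-- `M` is the mixed fiber polytope `Σ_ψ(P₁, …, Pᵣ)`, `r = l + 1`: the coefficient of `λ₁ ⋯ λᵣ`
in the expansion of `Σ_ψ(λ₁P₁ + ⋯ + λᵣPᵣ)` with polytopes as coefficients. -/
def IsMixedFiberPolytope {n l : ℕ}
    (ψ : EuclideanSpace ℝ (Fin n) →ₗ[ℝ] EuclideanSpace ℝ (Fin l))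
    (P : Fin (l + 1) → Polytope n) (M : Polytope n) : Prop :=
  ∃ N : (Fin (l + 1) → ℕ) → Polytope n, IsFiberExpansion ψ P N ∧ M = N (fun _ => 1)

end FiberPoly

/-! A polytope is determined by its support function, which is additive under Minkowski sums, so the
theorem is a statement about the function `c ↦ supp (Σ_ψ(∑ c j • P j)) w`. It has to be shown that
this is a homogeneous polynomial of degree `l + 1` in `c ≥ 0` and that each coefficient, as a
function of `w`, is again the support function of a polytope.

The support function is smoothed. With `P j = conv (V j)`, the vertex maximizing `⟪u, ·⟫` is
replaced by the Gibbs average of `V j`, the gradient of a log-partition function. Along the span of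
the rows of `ψ` these averages give a map `gradMap`, which in the nondegenerate case is a
diffeomorphism of `ℝˡ` onto the interior of the image under `ψ`. Inverting it gives a section that
is optimal in direction `u` up to a bounded error. In the coordinates of `gradMap` its integral is
`∫ det(jac) • meanComb`. The determinant is homogeneous of degree `l` in `c` and the mean is linear,
so the integral is a polynomial of degree `l + 1` (`inner_gibbsIntegral_eq_homPoly`). Replacing `u`
by `u + t • w` with `t → ∞` recovers the exact support function (`tendsto_inner_gibbsIntegral`).

A coefficient is a signed combination of support functions, so its sublinearity is not automatic. It
follows from monotonicity: the increment of the smoothed value from `u` to `u + t • e` is the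
integral of a Jacobian determinant in dimension `l + 1` (`inner_gibbsIntegral_sub`), and by
Cauchy–Binet that determinant has nonnegative coefficients in `c`. Sublinearity and piecewise
linearity together make the coefficient a support function (`exists_supp_eq_of_sublinear`).

Uniqueness holds because a polynomial is determined by its values on the positive orthant. The
expansion also holds at `0/1` vectors, where inclusion–exclusion isolates the squarefree coefficient
(`sum_powerset_homPoly`). -/

namespace FiberPoly
open Filter Topology

/-! ### Support functions of polytopes. -/

section Support

variable {E : Type*} [NormedAddCommGroup E] [InnerProductSpace ℝ E]

/-- The support function of a set. -/
noncomputable def supp (S : Set E) (w : E) : ℝ := sSup ((fun y => inner ℝ w y) '' S)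

theorem IsPolytope.isCompact {S : Set E} (hS : IsPolytope S) : IsCompact S := by
  obtain ⟨V, -, rfl⟩ := hS
  exact V.finite_toSet.isCompact_convexHull ℝ

theorem IsPolytope.convex {S : Set E} (hS : IsPolytope S) : Convex ℝ S := by
  obtain ⟨V, -, rfl⟩ := hS
  exact convex_convexHull ℝ _

theorem IsPolytope.nonempty {S : Set E} (hS : IsPolytope S) : S.Nonempty := by
  obtain ⟨V, hV, rfl⟩ := hS
  exact hV.to_set.convexHull

theorem inner_le_supp {S : Set E} (hS : IsCompact S) (w : E) {y : E} (hy : y ∈ S) :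
    inner ℝ w y ≤ supp S w :=
  le_csSup (hS.image (by fun_prop)).bddAbove ⟨y, hy, rfl⟩

theorem exists_inner_eq_supp {S : Set E} (hS : IsCompact S) (hne : S.Nonempty) (w : E) :
    ∃ y ∈ S, inner ℝ w y = supp S w :=
  (hS.image (f := fun y => inner ℝ w y) (by fun_prop)).sSup_mem (hne.image _)

theorem supp_le {S : Set E} (hne : S.Nonempty) {w : E} {c : ℝ} (h : ∀ y ∈ S, inner ℝ w y ≤ c) :
    supp S w ≤ c :=
  csSup_le (hne.image _) (by rintro _ ⟨y, hy, rfl⟩; exact h y hy)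

theorem supp_add {S T : Set E} (hS : IsPolytope S) (hT : IsPolytope T) (w : E) :
    supp (S + T) w = supp S w + supp T w := by
  apply le_antisymm
  · refine supp_le (hS.nonempty.add hT.nonempty) ?_
    rintro _ ⟨y, hy, z, hz, rfl⟩
    simp only [inner_add_right]
    exact add_le_add (inner_le_supp hS.isCompact w hy) (inner_le_supp hT.isCompact w hz)
  · obtain ⟨y, hy, h1⟩ := exists_inner_eq_supp hS.isCompact hS.nonempty w
    obtain ⟨z, hz, h2⟩ := exists_inner_eq_supp hT.isCompact hT.nonempty w
    rw [← h1, ← h2, ← inner_add_right]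
    exact inner_le_supp (hS.add hT).isCompact w (Set.add_mem_add hy hz)

theorem supp_smul {S : Set E} (hS : IsPolytope S) {c : ℝ} (hc : 0 ≤ c) (w : E) :
    supp (c • S) w = c * supp S w := by
  apply le_antisymm
  · refine supp_le hS.nonempty.smul_set ?_
    rintro _ ⟨y, hy, rfl⟩
    simp only [inner_smul_right]
    exact mul_le_mul_of_nonneg_left (inner_le_supp hS.isCompact w hy) hc
  · obtain ⟨y, hy, h1⟩ := exists_inner_eq_supp hS.isCompact hS.nonempty w
    rw [← h1, ← inner_smul_right]
    exact inner_le_supp (hS.smul c).isCompact w (Set.smul_mem_smul_set hy)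

theorem supp_arg_smul (S : Set E) {c : ℝ} (hc : 0 ≤ c) (w : E) :
    supp S (c • w) = c * supp S w := by
  rw [supp, supp, ← smul_eq_mul, ← Real.sSup_smul_of_nonneg hc, ← Set.image_smul, Set.image_image]
  simp only [inner_smul_left, smul_eq_mul, RCLike.conj_to_real]

/-- A point outside `T` is strictly separated from it by a functional, whose Riesz vector violates
the inequality of support functions. -/
theorem subset_of_supp_le [CompleteSpace E] {S T : Set E} (hS : IsPolytope S) (hT : IsPolytope T)
    (h : ∀ w, supp S w ≤ supp T w) : S ⊆ T := by
  intro y hy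
  by_contra hyT
  obtain ⟨f, c, h1, h2⟩ := geometric_hahn_banach_closed_point hT.convex hT.isCompact.isClosed hyT
  obtain ⟨z, hz, h3⟩ := exists_inner_eq_supp hT.isCompact hT.nonempty
    ((InnerProductSpace.toDual ℝ E).symm f)
  have h4 := inner_le_supp hS.isCompact ((InnerProductSpace.toDual ℝ E).symm f) hy
  have h5 := h ((InnerProductSpace.toDual ℝ E).symm f)
  rw [← h3] at h5
  rw [InnerProductSpace.toDual_symm_apply] at h4 h5
  linarith [h1 z hz]

theorem supp_injective [CompleteSpace E] {S T : Set E} (hS : IsPolytope S) (hT : IsPolytope T)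
    (h : supp S = supp T) : S = T :=
  (subset_of_supp_le hS hT fun w => (congrFun h w).le).antisymm
    (subset_of_supp_le hT hS fun w => (congrFun h w).ge)

theorem exists_mem_supp_convexHull {V : Finset E} (hV : V.Nonempty) (w : E) :
    ∃ v ∈ V, supp (convexHull ℝ (V : Set E)) w = inner ℝ w v := by
  obtain ⟨v, hv, hmax⟩ := V.exists_max_image (fun v => inner ℝ w v) hV
  refine ⟨v, hv, le_antisymm (supp_le hV.to_set.convexHull fun y hy => ?_)
    (inner_le_supp (V.finite_toSet.isCompact_convexHull ℝ) w (subset_convexHull ℝ _ hv))⟩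
  have hc : Convex ℝ {y : E | inner ℝ w y ≤ inner ℝ w v} :=
    convex_halfSpace_le (innerₛₗ ℝ w).isLinear _
  exact convexHull_min (fun u hu => hmax u hu) hc hy

/-- Unlike sublinearity, this form of piecewise linearity survives signed linear combinations. -/
theorem exists_finset_supp {S : Set E} (hS : IsPolytope S) :
    ∃ F : Finset E, ∀ w, ∃ v ∈ F, supp S w = inner ℝ w v := by
  obtain ⟨V, hV, rfl⟩ := hS
  exact ⟨V, exists_mem_supp_convexHull hV⟩

theorem continuous_supp {S : Set E} (hS : IsPolytope S) : Continuous (supp S) := by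
  obtain ⟨V, hV, rfl⟩ := hS
  have : supp (convexHull ℝ (V : Set E)) = fun w => V.sup' hV fun v => inner ℝ w v := by
    ext w
    obtain ⟨v, hv, h⟩ := exists_mem_supp_convexHull hV w
    apply le_antisymm
    · rw [h]
      exact Finset.le_sup' (fun v => inner ℝ w v) hv
    · exact Finset.sup'_le _ _ fun v hv => inner_le_supp
        (V.finite_toSet.isCompact_convexHull ℝ) w (subset_convexHull ℝ _ hv)
  rw [this]
  exact Continuous.finset_sup'_apply hV fun v _ => by fun_prop

/-- A continuous sublinear function all of whose values are values of finitely many linear forms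
is the support function of a polytope. -/
theorem exists_supp_eq_of_sublinear [FiniteDimensional ℝ E] (q : E → ℝ)
    (hc : Continuous q) (hadd : ∀ u w, q (u + w) ≤ q u + q w)
    (hsmul : ∀ c : ℝ, 0 ≤ c → ∀ u, q (c • u) = c * q u)
    (F : Finset E) (hF : ∀ w, ∃ a ∈ F, q w = inner ℝ w a) :
    ∃ M : Set E, IsPolytope M ∧ supp M = q := by
  classical
  let _ : MeasurableSpace E := borel E
  have : BorelSpace E := ⟨rfl⟩
  let S : Finset E := F.filter fun a => ∀ w, inner ℝ w a ≤ q w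
  -- Generic directions separate all candidate forms. The complement is a finite union of
  -- hyperplanes, hence null, so `G` is dense.
  let G : Set E := {u | ∀ a : F, ∀ b : F, a ≠ b → (inner ℝ u a.1 : ℝ) ≠ inner ℝ u b.1}
  have hG : Dense G := by
    have : ∀ᵐ u ∂(Measure.addHaar : Measure E), u ∈ G := by
      change ∀ᵐ u ∂(Measure.addHaar : Measure E), ∀ a : F, ∀ b : F,
        a ≠ b → (inner ℝ u a.1 : ℝ) ≠ inner ℝ u b.1
      rw [ae_all_iff]; intro a
      rw [ae_all_iff]; intro b
      by_cases hab : a = b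
      · simp [hab]
      have hK : LinearMap.ker (innerₛₗ ℝ (a.1 - b.1)) ≠ ⊤ := by
        intro h
        rw [LinearMap.ker_eq_top] at h
        have := LinearMap.congr_fun h (a.1 - b.1)
        rw [innerₛₗ_apply_apply, LinearMap.zero_apply, inner_self_eq_zero, sub_eq_zero] at this
        exact hab (Subtype.ext this)
      have h0 := Measure.addHaar_submodule (Measure.addHaar : Measure E) _ hK
      filter_upwards [compl_mem_ae_iff.2 h0] with u hu _ he
      apply hu
      rw [SetLike.mem_coe, LinearMap.mem_ker, innerₛₗ_apply_apply, real_inner_comm,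
        inner_sub_right, he, sub_self]
    exact Measure.dense_of_ae this
  have hGS : ∀ u ∈ G, ∃ a ∈ S, q u ≤ inner ℝ u a := by
    intro u hu
    obtain ⟨a, ha, hqa⟩ := hF u
    refine ⟨a, Finset.mem_filter.2 ⟨ha, fun w => ?_⟩, hqa.le⟩
    -- By continuity the form `a` active at a generic `u` stays active nearby. Then `q (u + t • w) ≤
    -- q u + t * q w` for small `t > 0` reads `⟪w, a⟫ ≤ q w`, so `a` lies in `S`.
    have hloc : ∀ᶠ v in 𝓝 u, ∀ b : F, b.1 ≠ a → q v ≠ inner ℝ v b.1 := by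
      rw [eventually_all]
      intro b
      by_cases hb : b.1 = a
      · simp [hb]
      have hne : q u ≠ inner ℝ u b.1 := by
        rw [hqa]
        exact hu ⟨a, ha⟩ b fun h => hb (congrArg Subtype.val h).symm
      have h1 : Continuous fun v : E => (inner ℝ v b.1 : ℝ) := by fun_prop
      have h2 : ∀ᶠ v in 𝓝 u, q v - inner ℝ v b.1 ≠ 0 :=
        (hc.sub h1).continuousAt.eventually_ne (sub_ne_zero.2 hne)
      exact h2.mono fun v hv _ => sub_ne_zero.1 hv
    have ht : Tendsto (fun t : ℝ => u + t • w) (𝓝[>] 0) (𝓝 u) := by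
      have : Continuous fun t : ℝ => u + t • w := by fun_prop
      simpa using (this.tendsto 0).mono_left nhdsWithin_le_nhds
    obtain ⟨t, h1, h2⟩ := ((ht.eventually hloc).and self_mem_nhdsWithin).exists
    have h2 : 0 < t := h2
    obtain ⟨b, hb, hqb⟩ := hF (u + t • w)
    have hba : b = a := by
      by_contra hne
      exact h1 ⟨b, hb⟩ hne hqb
    subst hba
    have h3 := hadd u (t • w)
    rw [hqb, hqa, hsmul t h2.le, inner_add_left, inner_smul_left] at h3
    simp only [RCLike.conj_to_real, add_le_add_iff_left] at h3
    exact le_of_mul_le_mul_left h3 h2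
  have hall : ∀ u, ∃ a ∈ S, q u ≤ inner ℝ u a := by
    have hcl : IsClosed (⋃ a ∈ S, {u | q u ≤ inner ℝ u a}) :=
      isClosed_biUnion_finset fun a _ => isClosed_le hc (by fun_prop)
    intro u
    have := hcl.closure_subset_iff.2 (fun v hv => by
      obtain ⟨a, ha, h⟩ := hGS v hv
      exact Set.mem_biUnion ha h) (hG u)
    simpa using this
  have hSne : S.Nonempty := by
    obtain ⟨a, ha, -⟩ := hall 0
    exact ⟨a, ha⟩
  refine ⟨convexHull ℝ S, ⟨S, hSne, rfl⟩, funext fun u => le_antisymm ?_ ?_⟩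
  · obtain ⟨v, hv, h⟩ := exists_mem_supp_convexHull hSne u
    rw [h]
    exact (Finset.mem_filter.1 hv).2 u
  · obtain ⟨a, ha, h⟩ := hall u
    exact h.trans (inner_le_supp (S.finite_toSet.isCompact_convexHull ℝ) u
      (subset_convexHull ℝ _ ha))

end Support

/-! ### Support functions of virtual polytopes. -/

/-- The support function as a homomorphism. -/
noncomputable def suppHom (n : ℕ) : Polytope n →+ (EuclideanSpace ℝ (Fin n) → ℝ) where
  toFun P := supp P.1
  map_zero' := by
    ext w
    change supp (0 : Set (EuclideanSpace ℝ (Fin n))) w = 0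
    simp [supp]
  map_add' P Q := by
    ext w
    exact supp_add P.2 Q.2 w

theorem suppHom_apply {n : ℕ} (P : Polytope n) : suppHom n P = supp P.1 := rfl

theorem suppHom_injective (n : ℕ) : Function.Injective (suppHom n) :=
  fun P Q h => Subtype.ext (supp_injective P.2 Q.2 h)

theorem suppHom_smul {n : ℕ} {c : ℝ} (hc : 0 ≤ c) (P : Polytope n) :
    suppHom n (c • P) = c • suppHom n P := by
  ext w
  exact supp_smul P.2 hc w

theorem lift_suppHom_of {n : ℕ} (P : Polytope n) :
    Algebra.GrothendieckAddGroup.lift (suppHom n) (Algebra.GrothendieckAddGroup.of P) =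
      suppHom n P :=
  DFunLike.congr_fun (Algebra.GrothendieckAddGroup.lift.symm_apply_apply (suppHom n)) P

theorem lift_suppHom_toVirtual {n : ℕ} (P : Polytope n) :
    Algebra.GrothendieckAddGroup.lift (suppHom n) P.toVirtual = suppHom n P :=
  lift_suppHom_of P

/-- Virtual polytopes are determined by their support functions. -/
theorem virtual_ext {n : ℕ} {x y : VirtualPolytope n}
    (h : Algebra.GrothendieckAddGroup.lift (suppHom n) x =
      Algebra.GrothendieckAddGroup.lift (suppHom n) y) : x = y := by
  rw [← sub_eq_zero] at h ⊢
  rw [← map_sub] at h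
  generalize x - y = z at h
  induction z using AddLocalization.ind with
  | _ z =>
    obtain ⟨a, b⟩ := z
    have e : AddLocalization.mk a b =
        Algebra.GrothendieckAddGroup.of a - Algebra.GrothendieckAddGroup.of b.1 := by
      have := Algebra.GrothendieckAddGroup.mk_sub_mk a b.1 0 0
      simp only [Algebra.GrothendieckAddGroup.of]
      change _ = (AddLocalization.addMonoidOf ⊤) a - (AddLocalization.addMonoidOf ⊤) b.1
      rw [← AddLocalization.mk_zero_eq_addMonoidOf_mk, ← AddLocalization.mk_zero_eq_addMonoidOf_mk,
        this]
      congr 1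
      · simp
      · exact Subtype.ext (by simp)
    rw [e, map_sub, sub_eq_zero, lift_suppHom_of, lift_suppHom_of] at h
    rw [e, suppHom_injective n h, sub_self]

/-! ### Coefficients of homogeneous polynomials. -/

section Polynomial

variable {J : Type*} [Fintype J] [DecidableEq J]

/-- The homogeneous polynomial of degree `d` with coefficients `a`. -/
noncomputable def homPoly (d : ℕ) (a : (J → ℕ) → ℝ) (c : J → ℝ) : ℝ :=
  ∑ i ∈ Finset.piAntidiag Finset.univ d, (∏ j, c j ^ i j) * a i

/-- Each coefficient is a combination of finitely many values at positive arguments. -/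
theorem exists_coeff_extraction (d : ℕ) {i : J → ℕ}
    (hi : i ∈ Finset.piAntidiag (Finset.univ : Finset J) d) :
    ∃ (s : Finset (J → ℝ)) (t : (J → ℝ) → ℝ), (∀ c ∈ s, ∀ j, 0 < c j) ∧
      ∀ a : (J → ℕ) → ℝ, ∑ c ∈ s, t c * homPoly d a c = a i := by
  classical
  let D := Finset.piAntidiag (Finset.univ : Finset J) d
  let m : (J → ℝ) → (D → ℝ) := fun c k => ∏ j, c j ^ k.1 j
  let pos : Set (J → ℝ) := {c | ∀ j, 0 < c j}
  have hspan : Submodule.span ℝ (m '' pos) = ⊤ := by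
    by_contra hne
    obtain ⟨f, hf0, hf⟩ := Submodule.exists_le_ker_of_lt_top _ (lt_top_iff_ne_top.2 hne)
    apply hf0
    -- A functional killing all positive monomial vectors is the coefficient vector of a polynomial
    -- vanishing on the positive orthant, so it is zero.
    let p : MvPolynomial J ℝ := ∑ k : D,
      MvPolynomial.monomial (Finsupp.equivFunOnFinite.symm k.1) (f (Pi.single k 1))
    have hev : ∀ c : J → ℝ, MvPolynomial.eval c p = f (m c) := by
      intro c
      rw [map_sum, LinearMap.pi_apply_eq_sum_univ f (m c)]
      refine Finset.sum_congr rfl fun k _ => ?_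
      rw [MvPolynomial.eval_monomial, Finsupp.prod_fintype _ _ (by simp), smul_eq_mul, mul_comm]
      simp only [m, Finsupp.equivFunOnFinite_symm_apply_apply]
      congr 2
      ext x
      simp [Pi.single_apply, eq_comm]
    have hp : p = 0 := by
      refine MvPolynomial.funext_set (fun _ => Set.Ioi (0 : ℝ)) (fun _ => Set.Ioi_infinite 0)
        fun c hc => ?_
      rw [hev, map_zero]
      exact hf (Submodule.subset_span ⟨c, fun j => hc j (Set.mem_univ j), rfl⟩)
    refine LinearMap.pi_ext' fun k => LinearMap.ext_ring ?_
    have hk := congrArg (MvPolynomial.coeff (Finsupp.equivFunOnFinite.symm k.1)) hp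
    simp only [p, MvPolynomial.coeff_sum, MvPolynomial.coeff_monomial,
      EmbeddingLike.apply_eq_iff_eq, MvPolynomial.coeff_zero, Subtype.coe_inj] at hk
    simpa using hk
  have hmem : (Pi.single ⟨i, hi⟩ 1 : D → ℝ) ∈ Submodule.span ℝ (m '' pos) := hspan ▸ trivial
  obtain ⟨T, hT, he⟩ := (Finsupp.mem_span_image_iff_linearCombination ℝ).1 hmem
  refine ⟨T.support, T, fun c hc => hT hc, fun a => ?_⟩
  have hval : ∀ k : D, ∑ c ∈ T.support, T c * m c k = (Pi.single ⟨i, hi⟩ 1 : D → ℝ) k := by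
    intro k
    rw [← he, Finsupp.linearCombination_apply, Finsupp.sum, Finset.sum_apply]
    rfl
  calc ∑ c ∈ T.support, T c * homPoly d a c
      = ∑ c ∈ T.support, ∑ k : D, T c * m c k * a k := by
        refine Finset.sum_congr rfl fun c _ => ?_
        rw [homPoly, Finset.mul_sum, ← Finset.sum_coe_sort]
        exact Finset.sum_congr rfl fun k _ => (mul_assoc _ _ _).symm
    _ = ∑ k : D, (∑ c ∈ T.support, T c * m c k) * a k := by
        rw [Finset.sum_comm]
        simp_rw [Finset.sum_mul]
    _ = a i := by
        simp_rw [hval]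
        simp [Pi.single_apply]

theorem homPoly_coeff_unique {d : ℕ} {a b : (J → ℕ) → ℝ}
    (h : ∀ c : J → ℝ, (∀ j, 0 < c j) → homPoly d a c = homPoly d b c) {i : J → ℕ}
    (hi : i ∈ Finset.piAntidiag (Finset.univ : Finset J) d) : a i = b i := by
  obtain ⟨s, t, hs, ht⟩ := exists_coeff_extraction d hi
  rw [← ht a, ← ht b]
  exact Finset.sum_congr rfl fun c hc => by rw [h c (hs c hc)]

theorem homPoly_succ_zero {d : ℕ} {a : (J → ℕ) → ℝ} {c : J → ℝ} (hc : ∀ j, c j = 0) :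
    homPoly (d + 1) a c = 0 := by
  refine Finset.sum_eq_zero fun i hi => ?_
  obtain ⟨j, hj⟩ : ∃ j, i j ≠ 0 := by
    by_contra! h
    have := (Finset.mem_piAntidiag.1 hi).1
    simp [h] at this
  rw [Finset.prod_eq_zero (Finset.mem_univ j) (by rw [hc, zero_pow hj]), zero_mul]

/-- A homogeneous polynomial of degree `card J`: alternating sums over the vertices of the cube
give the coefficient of the squarefree monomial. -/
theorem sum_powerset_homPoly (a : (J → ℕ) → ℝ) :
    ∑ I ∈ (Finset.univ : Finset J).powerset, (-1 : ℝ) ^ (Fintype.card J + I.card) *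
      homPoly (Fintype.card J) a (fun j => if j ∈ I then 1 else 0) = a fun _ => 1 := by
  have key : ∀ i ∈ Finset.piAntidiag (Finset.univ : Finset J) (Fintype.card J),
      ∑ I ∈ (Finset.univ : Finset J).powerset, (-1 : ℝ) ^ (Fintype.card J + I.card) *
        ∏ j, (if j ∈ I then (1 : ℝ) else 0) ^ i j = if i = fun _ => 1 then 1 else 0 := by
    intro i hi
    -- Because `0 ^ 0 = 1`, a factor outside `I` survives exactly when its exponent is zero.
    have hprod : ∀ I : Finset J, ∏ j, (if j ∈ I then (1 : ℝ) else 0) ^ i j =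
        (∏ j ∈ I, 1) * ∏ j ∈ Finset.univ \ I, if i j = 0 then (1 : ℝ) else 0 := by
      intro I
      rw [← Finset.prod_sdiff (Finset.subset_univ I), mul_comm]
      refine congrArg₂ _ (Finset.prod_congr rfl fun j hj => by simp [hj])
        (Finset.prod_congr rfl fun j hj => ?_)
      rw [if_neg (Finset.mem_sdiff.1 hj).2, zero_pow_eq]
    have hsign : ∀ I : Finset J, (-1 : ℝ) ^ (Fintype.card J + I.card) *
        ((∏ j ∈ I, 1) * ∏ j ∈ Finset.univ \ I, if i j = 0 then (1 : ℝ) else 0) =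
        (∏ j ∈ I, 1) * ∏ j ∈ Finset.univ \ I, -(if i j = 0 then (1 : ℝ) else 0) := by
      intro I
      rw [Finset.prod_neg, Finset.card_sdiff_of_subset (Finset.subset_univ I), Finset.card_univ]
      have : Fintype.card J + I.card = Fintype.card J - I.card + 2 * I.card := by
        have := Finset.card_le_univ I
        omega
      rw [this, pow_add, pow_mul]
      simp
    simp_rw [hprod, hsign]
    -- The alternating sum factors as `∏ j, (1 - [i j = 0])`, which vanishes unless all exponents
    -- are positive. Total degree `card J` then forces them all to be one.
    rw [← Finset.prod_add]
    split_ifs with h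
    · simp [h]
    · obtain ⟨j, hj⟩ : ∃ j, i j = 0 := by
        by_contra! hne
        apply h
        have h1 : ∀ j ∈ Finset.univ, 1 ≤ i j := fun j _ => Nat.one_le_iff_ne_zero.2 (hne j)
        have h2 : ∑ j : J, 1 = ∑ j, i j := by
          rw [(Finset.mem_piAntidiag.1 hi).1]
          simp
        exact funext fun j => ((Finset.sum_eq_sum_iff_of_le h1).1 h2 j (Finset.mem_univ j)).symm
      exact Finset.prod_eq_zero (Finset.mem_univ j) (by simp [hj])
  simp_rw [homPoly, Finset.mul_sum]
  rw [Finset.sum_comm]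
  simp_rw [← mul_assoc, ← Finset.sum_mul]
  rw [Finset.sum_congr rfl fun i hi => by rw [key i hi]]
  simp only [ite_mul, one_mul, zero_mul]
  rw [Finset.sum_ite_eq' _ (fun _ => 1) a, if_pos]
  simp [Finset.mem_piAntidiag]

/-- The exponent vector of the monomial `∏ k, c (σ k)`. -/
def exponent {ι : Type*} [Fintype ι] (σ : ι → J) (j : J) : ℕ :=
  (Finset.univ.filter fun k => σ k = j).card

/-- Terms are grouped by the number of times each index occurs. This turns multilinear expansions
into polynomials and keeps nonnegative coefficients nonnegative. -/
theorem sum_prod_eq_homPoly {ι : Type*} [Fintype ι] [DecidableEq ι] (y : (ι → J) → ℝ) (c : J → ℝ) :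
    ∑ σ : ι → J, (∏ k, c (σ k)) * y σ =
      homPoly (Fintype.card ι) (fun i => ∑ σ : ι → J with exponent σ = i, y σ) c := by
  have hm : ∀ σ : ι → J, ∏ k, c (σ k) = ∏ j, c j ^ exponent σ j := by
    intro σ
    rw [← Finset.prod_fiberwise Finset.univ σ]
    refine Finset.prod_congr rfl fun j _ => ?_
    rw [Finset.prod_congr rfl (g := fun _ => c j), Finset.prod_const, exponent]
    intro k hk
    rw [(Finset.mem_filter.1 hk).2]
  rw [homPoly, ← Finset.sum_fiberwise_of_maps_to (s := Finset.univ)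
    (t := Finset.piAntidiag Finset.univ (Fintype.card ι)) (g := exponent)]
  · refine Finset.sum_congr rfl fun i _ => ?_
    rw [Finset.mul_sum]
    refine Finset.sum_congr rfl fun σ hσ => ?_
    rw [hm, (Finset.mem_filter.1 hσ).2]
  · intro σ _
    rw [Finset.mem_piAntidiag]
    refine ⟨?_, fun _ _ => Finset.mem_univ _⟩
    have := Finset.card_eq_sum_card_fiberwise (f := σ) (s := Finset.univ) (t := Finset.univ)
      (fun _ _ => Finset.mem_coe.2 (Finset.mem_univ _))
    rw [Finset.card_univ] at this
    exact this.symm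

end Polynomial

/-! ### Gibbs averages of a finite point set. -/

section Gibbs

variable {E : Type*} [NormedAddCommGroup E] [InnerProductSpace ℝ E]

/-- The partition function of a finite set of points. -/
noncomputable def partition (V : Finset E) (u : E) : ℝ := ∑ a ∈ V, Real.exp (inner ℝ u a)

/-- The Gibbs weights at inverse temperature one. -/
noncomputable def gibbs (V : Finset E) (u a : E) : ℝ := Real.exp (inner ℝ u a) / partition V u

/-- The Gibbs average: a smoothing of the point of `V` that maximizes `⟪u, ·⟫`. -/
noncomputable def gibbsMean (V : Finset E) (u : E) : E := ∑ a ∈ V, gibbs V u a • a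

/-- The covariance of the Gibbs measure, the derivative of `gibbsMean`. -/
noncomputable def gibbsCov (V : Finset E) (u : E) : E →L[ℝ] E :=
  ∑ a ∈ V, ∑ b ∈ V, (gibbs V u a * gibbs V u b / 2) • (innerSL ℝ (a - b)).smulRight (a - b)

variable {V : Finset E}

theorem partition_pos (hV : V.Nonempty) (u : E) : 0 < partition V u :=
  Finset.sum_pos (fun _ _ => Real.exp_pos _) hV

theorem gibbs_pos (hV : V.Nonempty) (u a : E) : 0 < gibbs V u a :=
  div_pos (Real.exp_pos _) (partition_pos hV u)

theorem sum_gibbs (hV : V.Nonempty) (u : E) : ∑ a ∈ V, gibbs V u a = 1 := by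
  simp_rw [gibbs]
  rw [← Finset.sum_div]
  exact div_self (partition_pos hV u).ne'

theorem gibbsMean_mem (hV : V.Nonempty) (u : E) : gibbsMean V u ∈ convexHull ℝ (V : Set E) :=
  (convex_convexHull ℝ _).sum_mem (fun _ _ => (gibbs_pos hV u _).le) (sum_gibbs hV u)
    fun _ ha => subset_convexHull ℝ _ ha

theorem hasFDerivAt_exp_inner (a u : E) :
    HasFDerivAt (fun u : E => Real.exp (inner ℝ u a)) (Real.exp (inner ℝ u a) • innerSL ℝ a) u := by
  have h : HasFDerivAt (fun u : E => (inner ℝ u a : ℝ)) (innerSL ℝ a) u := by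
    have := (innerSL ℝ a).hasFDerivAt (x := u)
    exact this.congr_of_eventuallyEq (Eventually.of_forall fun v => real_inner_comm _ _)
  exact h.exp

theorem hasFDerivAt_partition (hV : V.Nonempty) (u : E) :
    HasFDerivAt (partition V) (partition V u • innerSL ℝ (gibbsMean V u)) u := by
  have h := HasFDerivAt.fun_sum (u := V) fun a _ => hasFDerivAt_exp_inner a u
  refine h.congr_fderiv ?_
  rw [gibbsMean, map_sum, Finset.smul_sum]
  refine Finset.sum_congr rfl fun a _ => ?_
  rw [map_smul, smul_smul, gibbs, mul_div_cancel₀ _ (partition_pos hV u).ne']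

theorem hasFDerivAt_log_partition (hV : V.Nonempty) (u : E) :
    HasFDerivAt (fun u => Real.log (partition V u)) (innerSL ℝ (gibbsMean V u)) u := by
  have h := (hasFDerivAt_partition hV u).log (partition_pos hV u).ne'
  rwa [smul_smul, inv_mul_cancel₀ (partition_pos hV u).ne', one_smul] at h

/-- The weight is the exponential of `⟪a, u⟫ - log (partition V u)`, whose gradient is `a -
gibbsMean V u`. -/
theorem hasFDerivAt_gibbs (hV : V.Nonempty) (u a : E) :
    HasFDerivAt (fun u => gibbs V u a) (gibbs V u a • innerSL ℝ (a - gibbsMean V u)) u := by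
  have hlog : ∀ u, gibbs V u a = Real.exp (inner ℝ a u - Real.log (partition V u)) := fun u => by
    rw [Real.exp_sub, Real.exp_log (partition_pos hV u), gibbs, real_inner_comm]
  have h1 : HasFDerivAt (fun u : E => (inner ℝ a u : ℝ)) (innerSL ℝ a) u :=
    (innerSL ℝ a).hasFDerivAt
  have h := (h1.sub (hasFDerivAt_log_partition hV u)).exp
  rw [map_sub, hlog]
  exact h.congr_of_eventuallyEq (Eventually.of_forall hlog)

/-- Expand the sum over pairs and use that the weights sum to one. The right side is what
differentiation produces; the pair form in `gibbsCov` shows a nonnegative combination of rank-one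
squares. -/
theorem inner_gibbsCov (hV : V.Nonempty) (u w : E) : gibbsCov V u w =
    ∑ a ∈ V, (gibbs V u a * inner ℝ (a - gibbsMean V u) w) • a := by
  have hs := sum_gibbs hV u
  set p := gibbs V u with hp
  set m := gibbsMean V u with hm
  have hm' : m = ∑ a ∈ V, p a • a := rfl
  have e : ∀ a b : E, (p a * p b / 2) • (inner ℝ (a - b) w • (a - b)) =
      (1 / 2 : ℝ) • (p b • ((p a * inner ℝ a w) • a) - (p b * inner ℝ b w) • (p a • a) +
        (p a • ((p b * inner ℝ b w) • b) - (p a * inner ℝ a w) • (p b • b))) := by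
    intro a b
    rw [inner_sub_left]
    module
  have hA : ∑ a ∈ V, ∑ b ∈ V, (p b • ((p a * inner ℝ a w) • a) - (p b * inner ℝ b w) • (p a • a)) =
      ∑ a ∈ V, (p a * inner ℝ (a - m) w) • a := by
    have hmw : ∑ b ∈ V, p b * inner ℝ b w = inner ℝ m w := by
      rw [hm', sum_inner]
      exact Finset.sum_congr rfl fun b _ => by rw [real_inner_smul_left]
    refine Finset.sum_congr rfl fun a _ => ?_
    rw [Finset.sum_sub_distrib, ← Finset.sum_smul, ← Finset.sum_smul, hs, hmw, inner_sub_left]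
    module
  simp only [gibbsCov, sum_apply, smul_apply,
    ContinuousLinearMap.smulRight_apply, innerSL_apply_apply]
  rw [← hp]
  simp_rw [e]
  simp_rw [← Finset.smul_sum, Finset.sum_add_distrib]
  rw [Finset.sum_comm (f := fun a b =>
    p a • ((p b * inner ℝ b w) • b) - (p a * inner ℝ a w) • (p b • b)), hA]
  module

theorem hasFDerivAt_gibbsMean (hV : V.Nonempty) (u : E) :
    HasFDerivAt (gibbsMean V) (gibbsCov V u) u := by
  have h := HasFDerivAt.fun_sum (u := V) fun a _ => (hasFDerivAt_gibbs hV u a).smul_const a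
  refine h.congr_fderiv ?_
  ext1 w
  rw [inner_gibbsCov hV]
  simp [mul_smul, inner_sub_left]

theorem contDiff_gibbs (hV : V.Nonempty) (a : E) : ContDiff ℝ 1 fun u => gibbs V u a := by
  have h : ∀ a : E, ContDiff ℝ 1 fun u : E => Real.exp (inner ℝ u a) := fun a =>
    (contDiff_id.inner ℝ contDiff_const).exp
  exact (h a).div (ContDiff.sum fun a _ => h a) fun u => (partition_pos hV u).ne'

theorem continuous_gibbs (hV : V.Nonempty) (a : E) : Continuous fun u => gibbs V u a :=
  (contDiff_gibbs hV a).continuous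

theorem contDiff_gibbsMean (hV : V.Nonempty) : ContDiff ℝ 1 (gibbsMean V) :=
  ContDiff.sum fun a _ => (contDiff_gibbs hV a).smul contDiff_const

theorem inner_le_log_partition (hV : V.Nonempty) (u : E) {y : E}
    (hy : y ∈ convexHull ℝ (V : Set E)) : inner ℝ u y ≤ Real.log (partition V u) := by
  have hc : Convex ℝ {y : E | inner ℝ u y ≤ Real.log (partition V u)} :=
    convex_halfSpace_le (innerₛₗ ℝ u).isLinear _
  refine convexHull_min (fun a ha => ?_) hc hy
  rw [Set.mem_ofPred_eq, Real.le_log_iff_exp_le (partition_pos hV u)]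
  exact Finset.single_le_sum (f := fun a => Real.exp (inner ℝ u a)) (fun _ _ => (Real.exp_pos _).le) ha

/-- The gap is the entropy `∑ p log (1/p)`, and each term is at most `1 - p ≤ 1`. The bound does not
depend on `u`, so it becomes negligible in the limit of large `u`. -/
theorem log_partition_le (hV : V.Nonempty) (u : E) :
    Real.log (partition V u) ≤ inner ℝ u (gibbsMean V u) + V.card := by
  have h : ∀ a ∈ V, gibbs V u a * (Real.log (partition V u) - inner ℝ u a) ≤ 1 := by
    intro a _
    have hp := gibbs_pos hV u a
    have h1 := Real.log_le_sub_one_of_pos (inv_pos.2 hp)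
    rw [Real.log_inv, gibbs, Real.log_div (Real.exp_pos _).ne' (partition_pos hV u).ne',
      Real.log_exp, neg_sub, ← gibbs] at h1
    calc _ ≤ gibbs V u a * ((gibbs V u a)⁻¹ - 1) := mul_le_mul_of_nonneg_left h1 hp.le
      _ = 1 - gibbs V u a := by field_simp
      _ ≤ 1 := by linarith
  have h2 := Finset.sum_le_sum h
  simp_rw [mul_sub, Finset.sum_sub_distrib, ← Finset.sum_mul] at h2
  rw [sum_gibbs hV, one_mul] at h2
  rw [gibbsMean, inner_sum]
  simp only [inner_smul_right, Finset.sum_const, nsmul_eq_mul, mul_one] at h2 ⊢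
  linarith

/-- A direction constant on `V` multiplies all exponentials by one common factor, which cancels. -/
theorem gibbs_add_of_const {u d : E} (hd : ∀ a ∈ V, ∀ b ∈ V, inner ℝ d (a - b) = 0) {a : E}
    (ha : a ∈ V) : gibbs V (u + d) a = gibbs V u a := by
  have h : ∀ b ∈ V, Real.exp (inner ℝ (u + d) b) =
      Real.exp (inner ℝ d a) * Real.exp (inner ℝ u b) := by
    intro b hb
    have := hd b hb a ha
    rw [inner_sub_right, sub_eq_zero] at this
    rw [inner_add_left, Real.exp_add, this, mul_comm]
  rw [gibbs, gibbs, partition, partition, Finset.sum_congr rfl h, ← Finset.mul_sum, h a ha,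
    mul_div_mul_left _ _ (Real.exp_pos _).ne']

theorem gibbsMean_add_of_const {u d : E} (hd : ∀ a ∈ V, ∀ b ∈ V, inner ℝ d (a - b) = 0) :
    gibbsMean V (u + d) = gibbsMean V u :=
  Finset.sum_congr rfl fun a ha => by rw [gibbs_add_of_const hd ha]

theorem gibbsCov_add_of_const {u d : E} (hd : ∀ a ∈ V, ∀ b ∈ V, inner ℝ d (a - b) = 0) :
    gibbsCov V (u + d) = gibbsCov V u :=
  Finset.sum_congr rfl fun a ha => Finset.sum_congr rfl fun b hb => by
    rw [gibbs_add_of_const hd ha, gibbs_add_of_const hd hb]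

theorem inner_gibbsCov_self (u w : E) : inner ℝ w (gibbsCov V u w) =
    ∑ a ∈ V, ∑ b ∈ V, gibbs V u a * gibbs V u b / 2 * (inner ℝ w (a - b)) ^ 2 := by
  simp only [gibbsCov, sum_apply, smul_apply,
    ContinuousLinearMap.smulRight_apply, innerSL_apply_apply, inner_sum, inner_smul_right]
  refine Finset.sum_congr rfl fun a _ => Finset.sum_congr rfl fun b _ => ?_
  rw [real_inner_comm w, sq]

end Gibbs

theorem isPolytope_sum {E J : Type*} [AddCommGroup E] [Module ℝ E] (s : Finset J) {S : J → Set E} (h : ∀ j ∈ s, IsPolytope (S j)) :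
    IsPolytope (∑ j ∈ s, S j) :=
  Finset.sum_induction _ IsPolytope (fun _ _ => IsPolytope.add) isPolytope_zero h

/-! ### Gibbs averages of Minkowski combinations. -/

section Family

variable {E : Type*} [NormedAddCommGroup E] [InnerProductSpace ℝ E] {J : Type*} [Fintype J]

/-- The Minkowski combination of the convex hulls. -/
def hullComb (V : J → Finset E) (c : J → ℝ) : Set E := ∑ j, c j • convexHull ℝ (V j : Set E)

/-- The Gibbs average of the family: a smoothed maximizer over `hullComb V c`. -/
noncomputable def meanComb (V : J → Finset E) (c : J → ℝ) (u : E) : E :=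
  ∑ j, c j • gibbsMean (V j) u

/-- The derivative of `meanComb`. -/
noncomputable def covComb (V : J → Finset E) (c : J → ℝ) (u : E) : E →L[ℝ] E :=
  ∑ j, c j • gibbsCov (V j) u

/-- A smoothing of the support function of `hullComb V c`. -/
noncomputable def lseComb (V : J → Finset E) (c : J → ℝ) (u : E) : ℝ :=
  ∑ j, c j * Real.log (partition (V j) u)

variable {V : J → Finset E} {c : J → ℝ}

theorem isPolytope_hullComb (hV : ∀ j, (V j).Nonempty) (c : J → ℝ) : IsPolytope (hullComb V c) :=
  isPolytope_sum _ fun j _ => IsPolytope.smul _ ⟨V j, hV j, rfl⟩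

theorem meanComb_mem (hV : ∀ j, (V j).Nonempty) (c : J → ℝ) (u : E) : meanComb V c u ∈ hullComb V c :=
  Set.mem_finsetSum _ _ _ |>.2 ⟨fun j => c j • gibbsMean (V j) u, fun _ =>
    Set.smul_mem_smul_set (gibbsMean_mem (hV _) u), rfl⟩

theorem inner_le_lseComb (hV : ∀ j, (V j).Nonempty) (hc : ∀ j, 0 ≤ c j) (u : E) {y : E} (hy : y ∈ hullComb V c) :
    inner ℝ u y ≤ lseComb V c u := by
  obtain ⟨g, hg, rfl⟩ := (Set.mem_finsetSum _ _ _).1 hy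
  rw [inner_sum]
  refine Finset.sum_le_sum fun j hj => ?_
  obtain ⟨z, hz, h⟩ := hg hj
  rw [← h]
  simp only [inner_smul_right]
  exact mul_le_mul_of_nonneg_left (inner_le_log_partition (hV j) u hz) (hc j)

theorem lseComb_le (hV : ∀ j, (V j).Nonempty) (hc : ∀ j, 0 ≤ c j) (u : E) :
    lseComb V c u ≤ inner ℝ u (meanComb V c u) + ∑ j, c j * (V j).card := by
  rw [meanComb, inner_sum, ← Finset.sum_add_distrib]
  refine Finset.sum_le_sum fun j _ => ?_
  rw [inner_smul_right, ← mul_add]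
  exact mul_le_mul_of_nonneg_left (log_partition_le (hV j) u) (hc j)

theorem hasFDerivAt_lseComb (hV : ∀ j, (V j).Nonempty) (u : E) :
    HasFDerivAt (lseComb V c) (innerSL ℝ (meanComb V c u)) u := by
  have h := HasFDerivAt.fun_sum (u := Finset.univ) fun j (_ : j ∈ Finset.univ) =>
    (hasFDerivAt_log_partition (hV j) u).const_mul (c j)
  refine h.congr_fderiv ?_
  simp only [meanComb, map_sum, map_smul]

theorem hasFDerivAt_meanComb (hV : ∀ j, (V j).Nonempty) (u : E) : HasFDerivAt (meanComb V c) (covComb V c u) u :=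
  HasFDerivAt.fun_sum fun j _ => (hasFDerivAt_gibbsMean (hV j) u).const_smul (c j)

theorem contDiff_meanComb (hV : ∀ j, (V j).Nonempty) : ContDiff ℝ 1 (meanComb V c) :=
  ContDiff.sum fun j _ => (contDiff_gibbsMean (hV j)).const_smul (c j)

theorem meanComb_add_of_const {u d : E}
    (hd : ∀ j, c j ≠ 0 → ∀ a ∈ V j, ∀ b ∈ V j, inner ℝ d (a - b) = 0) :
    meanComb V c (u + d) = meanComb V c u :=
  Finset.sum_congr rfl fun j _ => by
    by_cases h : c j = 0
    · simp [h]
    · rw [gibbsMean_add_of_const (hd j h)]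

theorem covComb_add_of_const {u d : E}
    (hd : ∀ j, c j ≠ 0 → ∀ a ∈ V j, ∀ b ∈ V j, inner ℝ d (a - b) = 0) :
    covComb V c (u + d) = covComb V c u :=
  Finset.sum_congr rfl fun j _ => by
    by_cases h : c j = 0
    · simp [h]
    · rw [gibbsCov_add_of_const (hd j h)]

theorem inner_covComb_self_pos (hV : ∀ j, (V j).Nonempty) (hc : ∀ j, 0 ≤ c j) (u : E) {w : E}
    (h : ∃ j, c j ≠ 0 ∧ ∃ a ∈ V j, ∃ b ∈ V j, inner ℝ w (a - b) ≠ (0 : ℝ)) :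
    0 < inner ℝ w (covComb V c u w) := by
  obtain ⟨j, hj, a, ha, b, hb, hab⟩ := h
  have hnn : ∀ j a b, 0 ≤ gibbs (V j) u a * gibbs (V j) u b / 2 * (inner ℝ w (a - b)) ^ 2 :=
    fun j a b => mul_nonneg (div_nonneg (mul_nonneg (gibbs_pos (hV j) u a).le
      (gibbs_pos (hV j) u b).le) zero_le_two) (sq_nonneg _)
  simp only [covComb, sum_apply, smul_apply, inner_sum,
    inner_smul_right, inner_gibbsCov_self]
  refine Finset.sum_pos' (fun i _ => mul_nonneg (hc i) (Finset.sum_nonneg fun a _ =>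
    Finset.sum_nonneg fun b _ => hnn i a b)) ⟨j, Finset.mem_univ j,
      mul_pos ((hc j).lt_of_ne' hj) ?_⟩
  refine Finset.sum_pos' (fun a _ => Finset.sum_nonneg fun b _ => hnn j a b) ⟨a, ha, ?_⟩
  refine Finset.sum_pos' (fun b _ => hnn j a b) ⟨b, hb, ?_⟩
  exact mul_pos (div_pos (mul_pos (gibbs_pos (hV j) u a) (gibbs_pos (hV j) u b)) two_pos)
    (sq_pos_of_ne_zero hab)

/-- The Gibbs average is strictly monotone in every direction that is not constant. -/
theorem inner_meanComb_sub_pos (hV : ∀ j, (V j).Nonempty) (hc : ∀ j, 0 ≤ c j) (u : E) {w : E}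
    (h : ∃ j, c j ≠ 0 ∧ ∃ a ∈ V j, ∃ b ∈ V j, inner ℝ w (a - b) ≠ (0 : ℝ)) :
    0 < inner ℝ w (meanComb V c (u + w) - meanComb V c u) := by
  let f : ℝ → ℝ := fun t => inner ℝ w (meanComb V c (u + t • w))
  have hf : ∀ t, HasDerivAt f (inner ℝ w (covComb V c (u + t • w) w)) t := by
    intro t
    have h1 : HasDerivAt (fun t : ℝ => u + t • w) w t := by
      simpa using ((hasDerivAt_id t).smul_const w).const_add u
    have h2 := (hasFDerivAt_meanComb hV (c := c) (u + t • w)).comp_hasDerivAt t h1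
    exact ((innerSL ℝ w).hasFDerivAt.comp_hasDerivAt t h2)
  have hmono : StrictMono f := strictMono_of_deriv_pos fun t => by
    rw [(hf t).deriv]
    exact inner_covComb_self_pos hV hc _ h
  have := hmono zero_lt_one
  simp only [f, zero_smul, add_zero, one_smul] at this
  rw [inner_sub_right]
  linarith

end Family

/-! ### A Cauchy–Binet formula. -/

section Determinant

variable {ι : Type*} [Fintype ι] [DecidableEq ι]

/-- Multilinear expansion in the rows gives a sum over all `κ`. Averaging it over permutations of
`ι` turns each term into a squared determinant, whence the factorial. The squares make the Jacobian
coefficients nonnegative. -/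
theorem det_sum_vecMulVec {K : Type*} [Fintype K] (t : K → ℝ) (q : K → ι → ℝ) :
    (∑ k, t k • Matrix.vecMulVec (q k) (q k)).det =
      ∑ κ : ι → K, (∏ i, t (κ i)) *
        ((Matrix.of fun i => q (κ i)).det ^ 2 / (Fintype.card ι).factorial) := by
  classical
  let f : (ι → K) → ℝ := fun κ => (∏ i, t (κ i)) * ((∏ i, q (κ i) i) *
    (Matrix.of fun i => q (κ i)).det)
  have h1 : (∑ k, t k • Matrix.vecMulVec (q k) (q k)).det = ∑ κ, f κ := by
    have e : (∑ k, t k • Matrix.vecMulVec (q k) (q k)) =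
        fun i => ∑ k, (t k * q k i) • q k := by
      ext i j
      simp [Matrix.sum_apply, Matrix.vecMulVec_apply, mul_assoc]
    rw [e]
    change Matrix.detRowAlternating.toMultilinearMap _ = _
    rw [MultilinearMap.map_sum]
    refine Finset.sum_congr rfl fun κ _ => ?_
    rw [MultilinearMap.map_smul_univ, Finset.prod_mul_distrib, smul_eq_mul, mul_assoc]
    rfl
  have h2 : ∀ σ : Equiv.Perm ι, ∑ κ, f κ = ∑ κ : ι → K, f (κ ∘ σ) := fun σ =>
    (Equiv.sum_comp (Equiv.arrowCongr σ.symm (Equiv.refl K)) f).symm.trans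
      (Finset.sum_congr rfl fun κ _ => by congr 1)
  have h3 : ∀ κ : ι → K, ∑ σ : Equiv.Perm ι, f (κ ∘ σ) =
      (∏ i, t (κ i)) * (Matrix.of fun i => q (κ i)).det ^ 2 := by
    intro κ
    have hs : ∀ σ : Equiv.Perm ι, f (κ ∘ σ) = (∏ i, t (κ i)) *
        ((Matrix.of fun i => q (κ i)).det *
          (Equiv.Perm.sign σ * ∏ i, (Matrix.of fun i => q (κ i)) (σ i) i)) := by
      intro σ
      have hd := Matrix.det_permute σ (Matrix.of fun i => q (κ i))
      have hd' : (Matrix.of fun i => q ((κ ∘ σ) i)).det =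
          Equiv.Perm.sign σ * (Matrix.of fun i => q (κ i)).det := hd
      simp only [f]
      rw [hd', Function.comp_def, Equiv.prod_comp σ fun i => t (κ i)]
      simp only [Matrix.of_apply]
      ring
    simp_rw [hs]
    rw [← Finset.mul_sum, ← Finset.mul_sum, ← Matrix.det_apply', sq]
  have h4 : (Fintype.card ι).factorial * ∑ κ, f κ =
      ∑ κ : ι → K, (∏ i, t (κ i)) * (Matrix.of fun i => q (κ i)).det ^ 2 := by
    calc ((Fintype.card ι).factorial : ℝ) * ∑ κ, f κ
        = ∑ σ : Equiv.Perm ι, ∑ κ, f κ := by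
          rw [Finset.sum_const, Finset.card_univ, Fintype.card_perm, nsmul_eq_mul]
      _ = ∑ σ : Equiv.Perm ι, ∑ κ : ι → K, f (κ ∘ σ) := Finset.sum_congr rfl fun σ _ => h2 σ
      _ = _ := by
          rw [Finset.sum_comm]
          exact Finset.sum_congr rfl fun κ _ => h3 κ
  have hne : ((Fintype.card ι).factorial : ℝ) ≠ 0 := by positivity
  rw [h1, ← mul_right_inj' hne, h4, Finset.mul_sum]
  refine Finset.sum_congr rfl fun κ _ => ?_
  field_simp

end Determinant

/-! ### The gradient map and its Jacobian as a polynomial in `c`. -/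

section Jacobian

variable {E : Type*} [NormedAddCommGroup E] [InnerProductSpace ℝ E] {J : Type*} [Fintype J]
  {ι : Type*}

/-- The products with the vectors `b i`. -/
noncomputable def coords (b : ι → E) : E →L[ℝ] (ι → ℝ) :=
  ContinuousLinearMap.pi fun i => innerSL ℝ (b i)

theorem coords_apply (b : ι → E) (y : E) (i : ι) : coords b y i = inner ℝ (b i) y := rfl

variable [Fintype ι]

/-- The transpose of `coords b`. -/
noncomputable def embed (b : ι → E) : (ι → ℝ) →L[ℝ] E :=
  ∑ i, (ContinuousLinearMap.proj (R := ℝ) (φ := fun _ : ι => ℝ) i).smulRight (b i)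

theorem embed_apply (b : ι → E) (v : ι → ℝ) : embed b v = ∑ i, v i • b i := by
  simp [embed]

theorem embed_single [DecidableEq ι] (b : ι → E) (i : ι) : embed b (Pi.single i 1) = b i := by
  simp [embed_apply, Pi.single_apply]

theorem inner_embed (b : ι → E) (v : ι → ℝ) (y : E) :
    inner ℝ (embed b v) y = v ⬝ᵥ coords b y := by
  simp [embed_apply, sum_inner, real_inner_smul_left, dotProduct, coords_apply]

/-- The gradient of the smoothed support function along an affine subspace. -/
noncomputable def gradMap (V : J → Finset E) (c : J → ℝ) (b : ι → E) (u : E) (v : ι → ℝ) : ι → ℝ :=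
  coords b (meanComb V c (u + embed b v))

/-- The derivative of `gradMap`. -/
noncomputable def jac (V : J → Finset E) (c : J → ℝ) (b : ι → E) (z : E) :
    (ι → ℝ) →L[ℝ] (ι → ℝ) :=
  (coords b).comp ((covComb V c z).comp (embed b))

variable {V : J → Finset E} {c : J → ℝ} {b : ι → E}

theorem contDiff_gradMap (hV : ∀ j, (V j).Nonempty) (u : E) :
    ContDiff ℝ 1 (gradMap V c b u) := by
  refine (coords b).contDiff.comp ((contDiff_meanComb hV).comp ?_)
  exact contDiff_const.add (embed b).contDiff

theorem hasFDerivAt_gradMap (hV : ∀ j, (V j).Nonempty) (u : E) (v : ι → ℝ) :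
    HasFDerivAt (gradMap V c b u) (jac V c b (u + embed b v)) v := by
  have h1 : HasFDerivAt (fun v => u + embed b v) (embed b) v :=
    (embed b).hasFDerivAt.const_add u
  exact (coords b).hasFDerivAt.comp v ((hasFDerivAt_meanComb hV _).comp v h1)

theorem dotProduct_jac (z : E) (v : ι → ℝ) :
    v ⬝ᵥ jac V c b z v = inner ℝ (embed b v) (covComb V c z (embed b v)) :=
  (inner_embed b v _).symm

variable [DecidableEq ι] [DecidableEq J]

/-- The coefficient of `∏ i, c (τ i)` in the Jacobian determinant. -/
noncomputable def jacCoeff (V : J → Finset E) (b : ι → E) (z : E) (τ : ι → J) : ℝ :=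
  ∑ κ : ι → Σ j, V j × V j with (fun i => (κ i).1) = τ,
    (∏ i, gibbs (V (κ i).1) z (κ i).2.1 * gibbs (V (κ i).1) z (κ i).2.2 / 2) *
      ((Matrix.of fun i => coords b ((κ i).2.1 - (κ i).2.2 : E)).det ^ 2 /
        (Fintype.card ι).factorial)

theorem jacCoeff_nonneg (hV : ∀ j, (V j).Nonempty) (z : E) (τ : ι → J) : 0 ≤ jacCoeff V b z τ :=
  Finset.sum_nonneg fun _ _ => mul_nonneg (Finset.prod_nonneg fun _ _ =>
    div_nonneg (mul_nonneg (gibbs_pos (hV _) z _).le (gibbs_pos (hV _) z _).le) zero_le_two)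
      (by positivity)

theorem continuous_jacCoeff (hV : ∀ j, (V j).Nonempty) (τ : ι → J) :
    Continuous fun z => jacCoeff V b z τ := by
  refine continuous_finsetSum _ fun κ _ => (continuous_finsetProd _ fun i _ => ?_).mul
    continuous_const
  exact ((continuous_gibbs (hV _) _).mul (continuous_gibbs (hV _) _)).div_const _

theorem det_jac (z : E) : (jac V c b z).det = ∑ τ : ι → J, (∏ i, c (τ i)) * jacCoeff V b z τ := by
  let K := Σ j, V j × V j
  let s : K → ℝ := fun k => gibbs (V k.1) z k.2.1 * gibbs (V k.1) z k.2.2 / 2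
  let q : K → ι → ℝ := fun k => coords b (k.2.1 - k.2.2 : E)
  have hM : LinearMap.toMatrix' (jac V c b z : (ι → ℝ) →ₗ[ℝ] (ι → ℝ)) =
      ∑ k : K, (c k.1 * s k) • Matrix.vecMulVec (q k) (q k) := by
    ext i i'
    rw [LinearMap.toMatrix'_apply, Matrix.sum_apply, Fintype.sum_sigma]
    simp only [jac, covComb, gibbsCov, ContinuousLinearMap.coe_coe, ContinuousLinearMap.comp_apply,
      sum_apply, smul_apply, map_sum, map_smul, Finset.sum_apply, Pi.smul_apply,
      ContinuousLinearMap.smulRight_apply, innerSL_apply_apply, smul_eq_mul, Matrix.smul_apply,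
      Matrix.vecMulVec_apply]
    refine Finset.sum_congr rfl fun j _ => ?_
    rw [Fintype.sum_prod_type, Finset.mul_sum, ← Finset.sum_coe_sort]
    refine Finset.sum_congr rfl fun a _ => ?_
    rw [Finset.mul_sum, ← Finset.sum_coe_sort]
    refine Finset.sum_congr rfl fun a' _ => ?_
    rw [embed_single]
    simp only [s, q, coords_apply]
    rw [real_inner_comm (b i')]
    ring
  rw [ContinuousLinearMap.det, ← LinearMap.det_toMatrix', hM, det_sum_vecMulVec,
    ← Finset.sum_fiberwise Finset.univ fun κ : ι → K => fun i => (κ i).1]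
  refine Finset.sum_congr rfl fun τ _ => ?_
  rw [jacCoeff, Finset.mul_sum]
  refine Finset.sum_congr rfl fun κ hκ => ?_
  rw [Finset.prod_mul_distrib, mul_assoc, ← (Finset.mem_filter.1 hκ).2]

theorem det_jac_nonneg (hV : ∀ j, (V j).Nonempty) (hc : ∀ j, 0 ≤ c j) (z : E) :
    0 ≤ (jac V c b z).det := by
  rw [det_jac]
  exact Finset.sum_nonneg fun τ _ => mul_nonneg (Finset.prod_nonneg fun _ _ => hc _)
    (jacCoeff_nonneg hV z τ)

end Jacobian

/-! ### The gradient map is a bijection onto the interior of the image. -/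

section GradMap

variable {E : Type*} [NormedAddCommGroup E] [InnerProductSpace ℝ E] {J : Type*}
  {ι : Type*} [Fintype ι]

/-- No direction of the subspace spanned by `b` is constant on all the sets `V j` with
`c j ≠ 0`. -/
def Nondeg (V : J → Finset E) (c : J → ℝ) (b : ι → E) : Prop :=
  ∀ v : ι → ℝ, v ≠ 0 →
    ∃ j, c j ≠ 0 ∧ ∃ a ∈ V j, ∃ a' ∈ V j, inner ℝ (embed b v) (a - a') ≠ (0 : ℝ)

variable {V : J → Finset E} {c : J → ℝ} {b : ι → E}

theorem exists_const_of_not_nondeg (hn : ¬ Nondeg V c b) : ∃ v : ι → ℝ, v ≠ 0 ∧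
    ∀ j, c j ≠ 0 → ∀ a ∈ V j, ∀ a' ∈ V j, inner ℝ (embed b v) (a - a') = (0 : ℝ) := by
  unfold Nondeg at hn
  push Not at hn
  exact hn

variable [Fintype J]

theorem gradMap_mem (hV : ∀ j, (V j).Nonempty) (u : E) (v : ι → ℝ) :
    gradMap V c b u v ∈ coords b '' hullComb V c :=
  ⟨_, meanComb_mem hV c _, rfl⟩

theorem gradMap_injective (hV : ∀ j, (V j).Nonempty) (hc : ∀ j, 0 ≤ c j) (hn : Nondeg V c b)
    (u : E) : Function.Injective (gradMap V c b u) := by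
  intro v v' h
  by_contra hne
  have h1 := inner_meanComb_sub_pos hV hc (u + embed b v') (hn (v - v') (sub_ne_zero.2 hne))
  have h2 : u + embed b v' + embed b (v - v') = u + embed b v := by
    rw [map_sub]
    abel
  rw [h2, inner_embed, map_sub] at h1
  have h3 : coords b (meanComb V c (u + embed b v)) - coords b (meanComb V c (u + embed b v')) = 0 :=
    sub_eq_zero.2 h
  rw [h3, dotProduct_zero] at h1
  exact lt_irrefl _ h1

theorem det_jac_ne_zero (hV : ∀ j, (V j).Nonempty) (hc : ∀ j, 0 ≤ c j) (hn : Nondeg V c b)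
    (z : E) : (jac V c b z).det ≠ 0 := by
  rw [ContinuousLinearMap.det, Ne, LinearMap.det_eq_zero_iff_ker_ne_bot, not_not,
    LinearMap.ker_eq_bot']
  intro v hv
  by_contra hne
  have h := inner_covComb_self_pos hV hc z (hn v hne)
  rw [← dotProduct_jac] at h
  have hv' : jac V c b z v = 0 := hv
  rw [hv', dotProduct_zero] at h
  exact lt_irrefl _ h

theorem covComb_eq_zero_of_const {z d : E}
    (hd : ∀ j, c j ≠ 0 → ∀ a ∈ V j, ∀ a' ∈ V j, inner ℝ d (a - a') = (0 : ℝ)) :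
    covComb V c z d = 0 := by
  rw [covComb, sum_apply]
  refine Finset.sum_eq_zero fun j _ => ?_
  by_cases hj : c j = 0
  · simp [hj]
  rw [smul_apply, gibbsCov, sum_apply, Finset.sum_eq_zero, smul_zero]
  intro a ha
  rw [sum_apply]
  refine Finset.sum_eq_zero fun a' ha' => ?_
  rw [smul_apply, ContinuousLinearMap.smulRight_apply, innerSL_apply_apply, real_inner_comm,
    hd j hj a ha a' ha', zero_smul, smul_zero]

theorem det_jac_eq_zero (hn : ¬ Nondeg V c b) (z : E) : (jac V c b z).det = 0 := by
  obtain ⟨v, hv, h⟩ := exists_const_of_not_nondeg hn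
  rw [ContinuousLinearMap.det, LinearMap.det_eq_zero_iff_ker_ne_bot]
  intro hker
  refine hv (LinearMap.ker_eq_bot'.1 hker v ?_)
  change coords b (covComb V c z (embed b v)) = 0
  rw [covComb_eq_zero_of_const h, map_zero]

theorem inner_eq_of_mem_convexHull {V : Finset E} {d : E}
    (hd : ∀ a ∈ V, ∀ a' ∈ V, inner ℝ d (a - a') = (0 : ℝ)) {y y' : E}
    (hy : y ∈ convexHull ℝ (V : Set E)) (hy' : y' ∈ convexHull ℝ (V : Set E)) :
    (inner ℝ d y : ℝ) = inner ℝ d y' := by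
  have hd' : ∀ a ∈ V, ∀ a' ∈ V, (inner ℝ d a : ℝ) = inner ℝ d a' := fun a ha a' ha' => by
    have := hd a ha a' ha'
    rwa [inner_sub_right, sub_eq_zero] at this
  have hconv : ∀ t : ℝ, Convex ℝ {y : E | inner ℝ d y = t} := fun t =>
    convex_hyperplane (innerₛₗ ℝ d).isLinear t
  have h1 : ∀ a ∈ V, ∀ y ∈ convexHull ℝ (V : Set E), (inner ℝ d y : ℝ) = inner ℝ d a :=
    fun a ha y hy => convexHull_min (fun a' ha' => hd' a' ha' a ha) (hconv (inner ℝ d a)) hy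
  exact (convexHull_min (fun a ha => (h1 a ha y' hy').symm) (hconv (inner ℝ d y')) hy)

/-- A constant direction `v` confines the image to a translate of the hyperplane orthogonal to `v`.
-/
theorem volume_image_eq_zero (hn : ¬ Nondeg V c b) :
    volume (coords b '' hullComb V c) = 0 := by
  obtain ⟨v, hv, h⟩ := exists_const_of_not_nondeg hn
  rcases (hullComb V c).eq_empty_or_nonempty with h0 | ⟨y₀, hy₀⟩
  · simp [h0]
  let K : Submodule ℝ (ι → ℝ) := LinearMap.ker (dotProductBilin ℝ ℝ v)
  have hK : K ≠ ⊤ := by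
    intro hK
    have hm : v ∈ K := hK ▸ trivial
    have hm' : v ⬝ᵥ v = 0 := hm
    exact hv (dotProduct_self_eq_zero.1 hm')
  have hsub : coords b '' hullComb V c ⊆ (fun x => x + -coords b y₀) ⁻¹' (K : Set (ι → ℝ)) := by
    rintro _ ⟨y, hy, rfl⟩
    change v ⬝ᵥ (coords b y + -coords b y₀) = 0
    rw [← map_neg, ← map_add, ← inner_embed, ← sub_eq_add_neg, inner_sub_right, sub_eq_zero]
    obtain ⟨g, hg, rfl⟩ := (Set.mem_finsetSum _ _ _).1 hy
    obtain ⟨g₀, hg₀, rfl⟩ := (Set.mem_finsetSum _ _ _).1 hy₀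
    rw [inner_sum, inner_sum]
    refine Finset.sum_congr rfl fun j hj => ?_
    obtain ⟨z, hz, h1⟩ := hg hj
    obtain ⟨z₀, hz₀, h2⟩ := hg₀ hj
    rw [← h1, ← h2]
    simp only [inner_smul_right]
    by_cases hcj : c j = 0
    · simp [hcj]
    · rw [inner_eq_of_mem_convexHull (h j hcj) hz hz₀]
  refine measure_mono_null hsub ?_
  rw [measure_preimage_add_right]
  exact Measure.addHaar_submodule volume K hK

/-- Every interior point is a gradient: minimize the Legendre functional. -/
theorem interior_subset_range_gradMap (hV : ∀ j, (V j).Nonempty) (hc : ∀ j, 0 ≤ c j) (u : E) :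
    interior (coords b '' hullComb V c) ⊆ Set.range (gradMap V c b u) := by
  classical
  intro x hx
  obtain ⟨δ, hδ, hball⟩ := Metric.nhds_basis_closedBall.mem_iff.1 (mem_interior_iff_mem_nhds.1 hx)
  obtain ⟨C, hC⟩ := (isPolytope_hullComb hV c).isCompact.isBounded.exists_norm_le
  -- The gradient of `f` at `v` is `gradMap V c b u v - x`, so a minimizer is a preimage of `x`. A
  -- minimizer exists since a ball around `x` inside the image makes `f` coercive.
  let f : (ι → ℝ) → ℝ := fun v => lseComb V c (u + embed b v) - v ⬝ᵥ x
  have hlow : ∀ v, ∀ y ∈ hullComb V c, v ⬝ᵥ (coords b y - x) - ‖u‖ * C ≤ f v := by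
    intro v y hy
    have h1 := inner_le_lseComb hV hc (u + embed b v) hy
    rw [inner_add_left, inner_embed] at h1
    have h2 : -(‖u‖ * C) ≤ inner ℝ u y := by
      have h3 := (abs_le.1 (abs_real_inner_le_norm u y)).1
      have h4 := mul_le_mul_of_nonneg_left (hC y hy) (norm_nonneg u)
      linarith
    simp only [f]
    rw [dotProduct_sub]
    linarith
  have hnorm : ∀ v, δ * ‖v‖ - ‖u‖ * C ≤ f v := by
    intro v
    have h0 : 0 ≤ f v + ‖u‖ * C := by
      obtain ⟨y, hy, hyx⟩ := interior_subset hx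
      have := hlow v y hy
      rw [hyx, sub_self, dotProduct_zero] at this
      linarith
    have h1 : ‖v‖ ≤ (f v + ‖u‖ * C) / δ := by
      rw [pi_norm_le_iff_of_nonneg (div_nonneg h0 hδ.le)]
      intro i
      rw [le_div_iff₀ hδ]
      -- Moving `x` by `δ` along the `i`-th axis in the direction of the sign of `v i` makes the
      -- lower bound for `f v` grow like `δ * |v i|`.
      have hmem : x + Pi.single i (δ * SignType.sign (v i)) ∈ Metric.closedBall x δ := by
        rw [mem_closedBall_iff_norm, add_sub_cancel_left, Pi.norm_single, norm_mul,
          Real.norm_of_nonneg hδ.le]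
        refine mul_le_of_le_one_right hδ.le ?_
        rcases lt_trichotomy (v i) 0 with h | h | h <;> simp [h]
      obtain ⟨y, hy, hyx⟩ := hball hmem
      have := hlow v y hy
      rw [hyx, add_sub_cancel_left, dotProduct_single] at this
      have e : v i * (δ * SignType.sign (v i)) = ‖v i‖ * δ := by
        rw [Real.norm_eq_abs, ← self_mul_sign (v i)]
        ring
      rw [e] at this
      linarith
    rw [le_div_iff₀ hδ] at h1
    linarith
  have hlse : ∀ v, HasFDerivAt (fun v => lseComb V c (u + embed b v))
      ((innerSL ℝ (meanComb V c (u + embed b v))).comp (embed b)) v := by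
    intro v
    have h1 : HasFDerivAt (fun v => u + embed b v) (embed b) v :=
      (embed b).hasFDerivAt.const_add u
    exact (hasFDerivAt_lseComb hV _).comp v h1
  let D : (ι → ℝ) →L[ℝ] ℝ := LinearMap.toContinuousLinearMap (dotProductBilin ℝ ℝ x)
  have hD : ∀ v, D v = v ⬝ᵥ x := fun v => dotProduct_comm x v
  have hf : ∀ v, HasFDerivAt f
      ((innerSL ℝ (meanComb V c (u + embed b v))).comp (embed b) - D) v := fun v => by
    have := (hlse v).sub (D.hasFDerivAt (x := v))
    exact this.congr_of_eventuallyEq (Eventually.of_forall fun v => by simp [f, hD])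
  have hcont : Continuous f := continuous_iff_continuousAt.2 fun v => (hf v).continuousAt
  have htend : Tendsto f (cocompact (ι → ℝ)) atTop :=
    tendsto_atTop_mono hnorm (tendsto_atTop_add_const_right _ _
      ((tendsto_norm_cocompact_atTop).const_mul_atTop hδ))
  obtain ⟨v, hv⟩ := hcont.exists_forall_le htend
  have hmin : IsLocalMin f v := Eventually.of_forall hv
  have hz := hmin.hasFDerivAt_eq_zero (hf v)
  refine ⟨v, funext fun i => ?_⟩
  have := DFunLike.congr_fun hz (Pi.single i 1)
  rw [sub_apply, hD, ContinuousLinearMap.comp_apply, innerSL_apply_apply,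
    single_one_dotProduct, zero_apply, sub_eq_zero, embed_single] at this
  rw [← this, gradMap, coords_apply, real_inner_comm]

/-- Since the Jacobian is invertible the map is open, so its range is an open part of the image; the
Legendre argument gives the other inclusion. -/
theorem range_gradMap (hV : ∀ j, (V j).Nonempty) (hc : ∀ j, 0 ≤ c j) (hn : Nondeg V c b) (u : E) :
    Set.range (gradMap V c b u) = interior (coords b '' hullComb V c) := by
  apply Set.Subset.antisymm _ (interior_subset_range_gradMap hV hc u)
  refine interior_maximal (Set.range_subset_iff.2 fun v => gradMap_mem hV u v) ?_
  have hs : ∀ v, HasStrictFDerivAt (gradMap V c b u)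
      ((jac V c b (u + embed b v)).toContinuousLinearEquivOfDetNeZero
        (det_jac_ne_zero hV hc hn _) : (ι → ℝ) →L[ℝ] (ι → ℝ)) v := fun v =>
    (contDiff_gradMap hV u).contDiffAt.hasStrictFDerivAt'
      (hasFDerivAt_gradMap hV u v) one_ne_zero
  exact (isOpenMap_of_hasStrictFDerivAt_equiv hs).isOpen_range

end GradMap

/-! ### Integrals of Gibbs sections as polynomials in `c`. -/

section ChangeOfVariables

variable {E : Type*} [NormedAddCommGroup E] [InnerProductSpace ℝ E] {J : Type*} [Fintype J]
  {ι : Type*} [Fintype ι] {V : J → Finset E} {c : J → ℝ} {b : ι → E}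

theorem continuous_meanComb_comp (hV : ∀ j, (V j).Nonempty) (u : E) :
    Continuous fun v => meanComb V c (u + embed b v) :=
  (contDiff_meanComb hV).continuous.comp (by fun_prop)

theorem volume_interior_lt_top (hV : ∀ j, (V j).Nonempty) (c : J → ℝ) (b : ι → E) :
    volume (interior (coords b '' hullComb V c)) < ⊤ :=
  (measure_mono interior_subset).trans_lt
    ((isPolytope_hullComb hV c).isCompact.image (coords b).continuous).measure_lt_top

/-- Change of variables along the gradient map. -/
theorem integrableOn_interior_iff {F : Type*} [NormedAddCommGroup F] [NormedSpace ℝ F]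
    (hV : ∀ j, (V j).Nonempty) (hc : ∀ j, 0 ≤ c j) (hn : Nondeg V c b) (u : E)
    (g : (ι → ℝ) → F) :
    IntegrableOn g (interior (coords b '' hullComb V c)) ↔
      Integrable fun v => (jac V c b (u + embed b v)).det • g (gradMap V c b u v) := by
  classical
  have h := integrableOn_image_iff_integrableOn_abs_det_fderiv_smul volume MeasurableSet.univ
    (fun v _ => (hasFDerivAt_gradMap (c := c) (b := b) hV u v).hasFDerivWithinAt)
    (gradMap_injective hV hc hn u).injOn g
  rw [Set.image_univ, range_gradMap hV hc hn, integrableOn_univ] at h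
  rw [h]
  simp_rw [abs_of_nonneg (det_jac_nonneg hV hc _)]

theorem integral_interior_eq {F : Type*} [NormedAddCommGroup F] [NormedSpace ℝ F]
    (hV : ∀ j, (V j).Nonempty) (hc : ∀ j, 0 ≤ c j) (hn : Nondeg V c b) (u : E)
    (g : (ι → ℝ) → F) :
    ∫ x in interior (coords b '' hullComb V c), g x =
      ∫ v, (jac V c b (u + embed b v)).det • g (gradMap V c b u v) := by
  classical
  have h := integral_image_eq_integral_abs_det_fderiv_smul volume MeasurableSet.univ
    (fun v _ => (hasFDerivAt_gradMap (c := c) (b := b) hV u v).hasFDerivWithinAt)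
    (gradMap_injective hV hc hn u).injOn g
  rw [Set.image_univ, range_gradMap hV hc hn, setIntegral_univ] at h
  rw [h]
  simp_rw [abs_of_nonneg (det_jac_nonneg hV hc _)]

/-- In the nondegenerate case, changing variables turns this into integrability of `1` over a set of
finite volume; otherwise the determinant is zero. -/
theorem integrable_det_jac (hV : ∀ j, (V j).Nonempty) (hc : ∀ j, 0 ≤ c j) (b : ι → E) (u : E) :
    Integrable fun v => (jac V c b (u + embed b v)).det := by
  by_cases hn : Nondeg V c b
  · have h := (integrableOn_interior_iff hV hc hn u fun _ => (1 : ℝ)).1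
      (integrableOn_const (volume_interior_lt_top hV c b).ne)
    simpa using h
  · simp_rw [det_jac_eq_zero hn]
    exact integrable_zero _ _ _

theorem integrable_det_jac_smul {F : Type*} [NormedAddCommGroup F] [NormedSpace ℝ F]
    (hV : ∀ j, (V j).Nonempty) (hc : ∀ j, 0 ≤ c j) (u : E) {g : (ι → ℝ) → F}
    (hg : Continuous g) {C : ℝ} (hC : ∀ v, ‖g v‖ ≤ C) :
    Integrable fun v => (jac V c b (u + embed b v)).det • g v :=
  (integrable_det_jac hV hc b u).smul_bdd C hg.aestronglyMeasurable (Eventually.of_forall hC)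

theorem integrable_jacCoeff [DecidableEq ι] [DecidableEq J] (hV : ∀ j, (V j).Nonempty) (b : ι → E)
    (u : E) (τ : ι → J) : Integrable fun v => jacCoeff V b (u + embed b v) τ := by
  -- At `c = 1` the determinant is the sum of all the nonnegative coefficients, so it dominates each
  -- one.
  refine (integrable_det_jac (c := fun _ => 1) hV (fun _ => zero_le_one) b u).mono'
    ((continuous_jacCoeff hV τ).comp (by fun_prop)).aestronglyMeasurable
    (Eventually.of_forall fun v => ?_)
  rw [Real.norm_of_nonneg (jacCoeff_nonneg hV _ τ), det_jac]
  simp only [Finset.prod_const_one, one_mul]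
  exact Finset.single_le_sum (fun τ _ => jacCoeff_nonneg hV _ τ) (Finset.mem_univ τ)

/-- Integrals of the Jacobian are polynomials with nonnegative coefficients. -/
theorem setIntegral_det_jac_eq_homPoly [DecidableEq J] (hV : ∀ j, (V j).Nonempty) (b : ι → E)
    (u : E) (S : Set (ι → ℝ)) :
    ∃ a : (J → ℕ) → ℝ, (∀ i, 0 ≤ a i) ∧ ∀ c : J → ℝ,
      ∫ v in S, (jac V c b (u + embed b v)).det = homPoly (Fintype.card ι) a c := by
  classical
  refine ⟨fun i => ∑ σ : ι → J with exponent σ = i, ∫ v in S, jacCoeff V b (u + embed b v) σ,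
    fun i => Finset.sum_nonneg fun σ _ => integral_nonneg fun v => jacCoeff_nonneg hV _ σ,
    fun c => ?_⟩
  rw [← sum_prod_eq_homPoly]
  simp_rw [det_jac]
  rw [integral_finsetSum _ fun σ _ =>
    ((integrable_jacCoeff hV b u σ).integrableOn.const_mul _)]
  exact Finset.sum_congr rfl fun σ _ => integral_const_mul _ _

/-- The integral of the smoothed optimal section, in gradient coordinates. -/
noncomputable def gibbsIntegral (V : J → Finset E) (c : J → ℝ) (b : ι → E) (u : E) : E :=
  ∫ v, (jac V c b (u + embed b v)).det • meanComb V c (u + embed b v)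

/-- The smoothed optimal section. -/
noncomputable def gibbsSection (V : J → Finset E) (c : J → ℝ) (b : ι → E) (u : E)
    (x : ι → ℝ) : E :=
  meanComb V c (u + embed b (Function.invFun (gradMap V c b u) x))

theorem gibbsSection_mem (hV : ∀ j, (V j).Nonempty) (u : E) (x : ι → ℝ) :
    gibbsSection V c b u x ∈ hullComb V c :=
  meanComb_mem hV c _

theorem gibbsSection_gradMap (hV : ∀ j, (V j).Nonempty) (hc : ∀ j, 0 ≤ c j) (hn : Nondeg V c b)
    (u : E) (v : ι → ℝ) :
    gibbsSection V c b u (gradMap V c b u v) = meanComb V c (u + embed b v) := by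
  rw [gibbsSection, Function.leftInverse_invFun (gradMap_injective hV hc hn u)]

theorem coords_gibbsSection (hV : ∀ j, (V j).Nonempty) (hc : ∀ j, 0 ≤ c j) (u : E) {x : ι → ℝ}
    (hx : x ∈ interior (coords b '' hullComb V c)) : coords b (gibbsSection V c b u x) = x :=
  Function.invFun_eq (interior_subset_range_gradMap hV hc u hx)

theorem exists_norm_meanComb_le (hV : ∀ j, (V j).Nonempty) (c : J → ℝ) :
    ∃ C : ℝ, ∀ u, ‖meanComb V c u‖ ≤ C := by
  obtain ⟨C, hC⟩ := (isPolytope_hullComb hV c).isCompact.isBounded.exists_norm_le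
  exact ⟨C, fun u => hC _ (meanComb_mem hV c u)⟩

theorem integrable_gibbsIntegral (hV : ∀ j, (V j).Nonempty) (hc : ∀ j, 0 ≤ c j) (u : E) :
    Integrable fun v => (jac V c b (u + embed b v)).det • meanComb V c (u + embed b v) := by
  obtain ⟨C, hC⟩ := exists_norm_meanComb_le hV c
  exact integrable_det_jac_smul hV hc u (continuous_meanComb_comp hV u) fun v => hC _

theorem integrableOn_gibbsSection (hV : ∀ j, (V j).Nonempty) (hc : ∀ j, 0 ≤ c j)
    (hn : Nondeg V c b) (u : E) :
    IntegrableOn (gibbsSection V c b u) (interior (coords b '' hullComb V c)) := by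
  rw [integrableOn_interior_iff hV hc hn u]
  simp_rw [gibbsSection_gradMap hV hc hn]
  exact integrable_gibbsIntegral hV hc u

theorem integral_gibbsSection (hV : ∀ j, (V j).Nonempty) (hc : ∀ j, 0 ≤ c j)
    (hn : Nondeg V c b) (u : E) :
    ∫ x in interior (coords b '' hullComb V c), gibbsSection V c b u x =
      gibbsIntegral V c b u := by
  rw [integral_interior_eq hV hc hn u]
  simp_rw [gibbsSection_gradMap hV hc hn]
  rfl

theorem gibbsIntegral_eq_zero (hn : ¬ Nondeg V c b) (u : E) : gibbsIntegral V c b u = 0 := by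
  simp [gibbsIntegral, det_jac_eq_zero hn]

/-- The Gibbs section is optimal up to a constant. -/
theorem inner_le_inner_gibbsSection (hV : ∀ j, (V j).Nonempty) (hc : ∀ j, 0 ≤ c j) (u : E)
    {x : ι → ℝ} (hx : x ∈ interior (coords b '' hullComb V c)) {y : E} (hy : y ∈ hullComb V c)
    (hyx : coords b y = x) :
    inner ℝ u y ≤ inner ℝ u (gibbsSection V c b u x) + ∑ j, c j * (V j).card := by
  have hs := coords_gibbsSection hV hc u hx
  set v := Function.invFun (gradMap V c b u) x
  have h1 := inner_le_lseComb hV hc (u + embed b v) hy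
  have h2 := lseComb_le hV hc (u + embed b v)
  have h3 : gibbsSection V c b u x = meanComb V c (u + embed b v) := rfl
  rw [← h3, inner_add_left, inner_embed, hs] at h2
  rw [inner_add_left, inner_embed, hyx] at h1
  linarith

theorem inner_gibbsIntegral_eq_homPoly [CompleteSpace E] [DecidableEq J] {l : ℕ} (hV : ∀ j, (V j).Nonempty)
    (b : Fin l → E) (u w : E) : ∃ a : (J → ℕ) → ℝ, ∀ c : J → ℝ, (∀ j, 0 ≤ c j) →
      inner ℝ w (gibbsIntegral V c b u) = homPoly (l + 1) a c := by
  have hint : ∀ τ : Fin l → J, ∀ j, Integrable fun v =>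
      jacCoeff V b (u + embed b v) τ * inner ℝ w (gibbsMean (V j) (u + embed b v)) := by
    intro τ j
    obtain ⟨C, hC⟩ := ((V j).finite_toSet.isCompact_convexHull ℝ).isBounded.exists_norm_le
    refine (integrable_jacCoeff hV b u τ).mul_bdd (c := ‖w‖ * C)
      (continuous_const.inner ((contDiff_gibbsMean (hV j)).continuous.comp (by fun_prop))).aestronglyMeasurable
      (Eventually.of_forall fun v => ?_)
    exact (norm_inner_le_norm _ _).trans
      (mul_le_mul_of_nonneg_left (hC _ (gibbsMean_mem (hV j) _)) (norm_nonneg w))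
  let y : (Fin (l + 1) → J) → ℝ := fun σ => ∫ v,
    jacCoeff V b (u + embed b v) (Fin.tail σ) * inner ℝ w (gibbsMean (V (σ 0)) (u + embed b v))
  refine ⟨fun i => ∑ σ : Fin (l + 1) → J with exponent σ = i, y σ, fun c hc => ?_⟩
  have h := sum_prod_eq_homPoly y c
  rw [Fintype.card_fin] at h
  rw [← h, gibbsIntegral, ← integral_inner (integrable_gibbsIntegral hV hc u)]
  have hexp : ∀ v, inner ℝ w ((jac V c b (u + embed b v)).det • meanComb V c (u + embed b v)) =
      ∑ p : J × (Fin l → J), (c p.1 * ∏ k, c (p.2 k)) *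
        (jacCoeff V b (u + embed b v) p.2 * inner ℝ w (gibbsMean (V p.1) (u + embed b v))) := by
    intro v
    rw [Fintype.sum_prod_type, inner_smul_right, meanComb, inner_sum, Finset.mul_sum, det_jac]
    refine Finset.sum_congr rfl fun j _ => ?_
    rw [inner_smul_right, Finset.sum_mul]
    exact Finset.sum_congr rfl fun τ _ => by ring
  simp_rw [hexp]
  rw [integral_finsetSum _ fun p _ => (hint p.2 p.1).const_mul _]
  -- The entry `σ 0` indexes the summand of the mean and the tail the `l` factors of the Jacobian;
  -- together they give degree `l + 1`.
  refine Fintype.sum_equiv (Fin.consEquiv fun _ => J) _ _ fun p => ?_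
  rw [integral_const_mul, Fin.prod_univ_succ]
  rfl

end ChangeOfVariables

/-! ### Monotonicity of the smoothed optimal value. -/

section Monotone

variable {E : Type*} [NormedAddCommGroup E] [InnerProductSpace ℝ E] {J : Type*}
  {l : ℕ} {V : J → Finset E} {c : J → ℝ} {b : Fin l → E}

theorem embed_cons (e : E) (b : Fin l → E) (v : Fin (l + 1) → ℝ) :
    embed (Fin.cons e b : Fin (l + 1) → E) v = v 0 • e + embed b (Fin.tail v) := by
  simp [embed_apply, Fin.sum_univ_succ, Fin.tail]

theorem Nondeg.of_cons {e : E} (hn : Nondeg V c (Fin.cons e b : Fin (l + 1) → E)) :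
    Nondeg V c b := by
  intro v hv
  have h := hn (Fin.cons 0 v) fun h0 => hv (by
    have := congrArg Fin.tail h0
    rw [Fin.tail_cons] at this
    exact this)
  rwa [embed_cons, Fin.cons_zero, zero_smul, zero_add, Fin.tail_cons] at h

variable [Fintype J]

theorem gradMap_cons (e u : E) (v : Fin (l + 1) → ℝ) :
    gradMap V c (Fin.cons e b : Fin (l + 1) → E) u v =
      Fin.cons (inner ℝ e (meanComb V c (u + v 0 • e + embed b (Fin.tail v))))
        (gradMap V c b (u + v 0 • e) (Fin.tail v)) := by
  funext i
  refine Fin.cases ?_ (fun i => ?_) i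
  · rw [gradMap, embed_cons, coords_apply, Fin.cons_zero, Fin.cons_zero, add_assoc]
  · rw [gradMap, embed_cons, coords_apply, Fin.cons_succ, Fin.cons_succ, gradMap, coords_apply,
      add_assoc]

/-- A direction that is constant modulo the subspace does not change the integral. -/
theorem gibbsIntegral_add_smul_of_degenerate {e : E} (hn : Nondeg V c b)
    (hn' : ¬ Nondeg V c (Fin.cons e b : Fin (l + 1) → E)) (u : E) (t : ℝ) :
    gibbsIntegral V c b (u + t • e) = gibbsIntegral V c b u := by
  obtain ⟨v', hv', hd⟩ := exists_const_of_not_nondeg hn'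
  rw [embed_cons] at hd
  set σ := v' 0 with hσ
  set w := Fin.tail v' with hw
  have hσ0 : σ ≠ 0 := by
    intro h0
    rw [h0, zero_smul, zero_add] at hd
    have hw0 : w ≠ 0 := by
      intro hw0
      apply hv'
      rw [← Fin.cons_self_tail v', ← hσ, ← hw, h0, hw0]
      funext i
      refine Fin.cases ?_ (fun i => ?_) i <;> simp
    obtain ⟨j, hj, a, ha, a', ha', h⟩ := hn w hw0
    exact h (hd j hj a ha a' ha')
  -- Scaled so that its `e`-part is `t • e`. Adding `d` changes neither mean nor Jacobian, and the
  -- remaining part in the span of `b` is absorbed by translating the integration variable.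
  set d : E := (t / σ) • (σ • e + embed b w) with hd'
  have hdc : ∀ j, c j ≠ 0 → ∀ a ∈ V j, ∀ a' ∈ V j, inner ℝ d (a - a') = (0 : ℝ) := by
    intro j hj a ha a' ha'
    rw [hd', inner_smul_left, hd j hj a ha a' ha', mul_zero]
  have hz : ∀ v, u + t • e + embed b v = u + embed b (v - (t / σ) • w) + d := by
    intro v
    have : (t / σ) • (σ • e) = t • e := by rw [smul_smul, div_mul_cancel₀ _ hσ0]
    rw [hd', smul_add, this, map_sub, map_smul]
    abel
  have hF : ∀ v, (jac V c b (u + t • e + embed b v)).det • meanComb V c (u + t • e + embed b v) =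
      (fun v => (jac V c b (u + embed b v)).det • meanComb V c (u + embed b v))
        (v - (t / σ) • w) := by
    intro v
    rw [hz, meanComb_add_of_const hdc, jac, covComb_add_of_const hdc]
    rfl
  rw [gibbsIntegral, integral_congr_ae (Eventually.of_forall hF)]
  exact integral_sub_right_eq_self (μ := (volume : Measure (Fin l → ℝ)))
    (fun v => (jac V c b (u + embed b v)).det • meanComb V c (u + embed b v)) ((t / σ) • w)

/-- Apply strict monotonicity of `meanComb` to the two parameters over the same `x`. The section
values have equal `b`-coordinates, so only the `e`-component of the displacement contributes. -/
theorem inner_gibbsSection_lt (hV : ∀ j, (V j).Nonempty) (hc : ∀ j, 0 ≤ c j) {e : E}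
    (hn : Nondeg V c (Fin.cons e b : Fin (l + 1) → E)) (u : E) {x : Fin l → ℝ}
    (hx : x ∈ interior (coords b '' hullComb V c)) :
    StrictMono fun s : ℝ => (inner ℝ e (gibbsSection V c b (u + s • e) x) : ℝ) := by
  intro s s' hs
  have h1 := coords_gibbsSection hV hc (u + s • e) hx
  have h2 := coords_gibbsSection hV hc (u + s' • e) hx
  set v := Function.invFun (gradMap V c b (u + s • e)) x with hv
  set v' := Function.invFun (gradMap V c b (u + s' • e)) x with hv'
  have e1 : gibbsSection V c b (u + s • e) x = meanComb V c (u + s • e + embed b v) := rfl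
  have e2 : gibbsSection V c b (u + s' • e) x = meanComb V c (u + s' • e + embed b v') := rfl
  have hne : (Fin.cons (s' - s) (v' - v) : Fin (l + 1) → ℝ) ≠ 0 := fun h => by
    have := congrFun h 0
    rw [Fin.cons_zero, Pi.zero_apply] at this
    linarith
  have h3 := inner_meanComb_sub_pos hV hc (u + s • e + embed b v) (hn _ hne)
  have hz : u + s • e + embed b v +
      embed (Fin.cons e b : Fin (l + 1) → E) (Fin.cons (s' - s) (v' - v)) =
      u + s' • e + embed b v' := by
    rw [embed_cons, Fin.cons_zero, Fin.tail_cons, map_sub, sub_smul]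
    abel
  rw [hz, ← e1, ← e2, embed_cons, Fin.cons_zero, Fin.tail_cons, inner_add_left, inner_embed,
    map_sub, h1, h2, sub_self, dotProduct_zero, add_zero, real_inner_smul_left, inner_sub_right] at h3
  exact sub_pos.1 (pos_of_mul_pos_right h3 (sub_pos.2 hs).le)

/-- The image of a slab under the gradient map in one dimension more. -/
theorem gradMap_cons_image_slab (hV : ∀ j, (V j).Nonempty) (hc : ∀ j, 0 ≤ c j) {e : E}
    (hn : Nondeg V c (Fin.cons e b : Fin (l + 1) → E)) (u : E) (t : ℝ) :
    gradMap V c (Fin.cons e b : Fin (l + 1) → E) u '' {v | 0 < v 0 ∧ v 0 < t} =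
      {x : Fin (l + 1) → ℝ | ((Fin.tail x, x 0) : (Fin l → ℝ) × ℝ) ∈ regionBetween
        (fun x => inner ℝ e (gibbsSection V c b u x))
        (fun x => inner ℝ e (gibbsSection V c b (u + t • e) x))
        (interior (coords b '' hullComb V c))} := by
  have hn0 := hn.of_cons
  have hf0 : ∀ x, (inner ℝ e (gibbsSection V c b u x) : ℝ) =
      inner ℝ e (gibbsSection V c b (u + (0 : ℝ) • e) x) := fun x => by rw [zero_smul, add_zero]
  have hval : ∀ v : Fin (l + 1) → ℝ,
      gradMap V c (Fin.cons e b : Fin (l + 1) → E) u v =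
        Fin.cons (inner ℝ e (gibbsSection V c b (u + v 0 • e)
          (gradMap V c b (u + v 0 • e) (Fin.tail v))))
          (gradMap V c b (u + v 0 • e) (Fin.tail v)) := fun v => by
    rw [gradMap_cons, gibbsSection_gradMap hV hc hn0]
  have hmem : ∀ (s : ℝ) (v : Fin l → ℝ), gradMap V c b (u + s • e) v ∈ interior (coords b '' hullComb V c) :=
    fun s v => range_gradMap hV hc hn0 (u + s • e) ▸ Set.mem_range_self v
  ext x
  rw [Set.mem_ofPred_eq, regionBetween, Set.mem_ofPred_eq, hf0]
  constructor
  · rintro ⟨v, ⟨h0, ht⟩, rfl⟩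
    rw [hval, Fin.tail_cons, Fin.cons_zero]
    have hm := hmem (v 0) (Fin.tail v)
    exact ⟨hm, inner_gibbsSection_lt hV hc hn u hm h0, inner_gibbsSection_lt hV hc hn u hm ht⟩
  · rintro ⟨hx, h0, ht⟩
    -- The points of the two bounding graphs over `Fin.tail x` lie in the convex interior, hence so
    -- does `x` between them, and `x` is therefore a value of the larger gradient map.
    have hpt : ∀ s : ℝ, (Fin.cons (inner ℝ e (gibbsSection V c b (u + s • e) (Fin.tail x)))
        (Fin.tail x) : Fin (l + 1) → ℝ) ∈
        interior (coords (Fin.cons e b : Fin (l + 1) → E) '' hullComb V c) := by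
      intro s
      rw [← range_gradMap hV hc hn u]
      obtain ⟨v, hv⟩ := interior_subset_range_gradMap hV hc (u + s • e) hx
      refine ⟨Fin.cons s v, ?_⟩
      rw [hval, Fin.cons_zero, Fin.tail_cons, hv]
    have hconv : Convex ℝ (interior (coords (Fin.cons e b : Fin (l + 1) → E) '' hullComb V c)) :=
      ((isPolytope_hullComb hV c).convex.linear_image
        (coords (Fin.cons e b : Fin (l + 1) → E)).toLinearMap).interior
    have hx' : x ∈ interior (coords (Fin.cons e b : Fin (l + 1) → E) '' hullComb V c) := by
      set α : ℝ := inner ℝ e (gibbsSection V c b (u + (0 : ℝ) • e) (Fin.tail x))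
      set β : ℝ := inner ℝ e (gibbsSection V c b (u + t • e) (Fin.tail x))
      have hx0 : x 0 ∈ openSegment ℝ α β := by
        rw [openSegment_eq_Ioo (h0.trans ht)]
        exact ⟨h0, ht⟩
      obtain ⟨p, q, hp, hq, hpq, hxpq⟩ := hx0
      have := hconv (hpt 0) (hpt t) hp.le hq.le hpq
      convert this using 1
      funext i
      refine Fin.cases ?_ (fun i => ?_) i
      · exact hxpq.symm
      · simp only [Pi.add_apply, Pi.smul_apply, Fin.cons_succ, smul_eq_mul, Fin.tail]
        rw [← add_mul, hpq, one_mul]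
    rw [← range_gradMap hV hc hn u] at hx'
    obtain ⟨v, rfl⟩ := hx'
    rw [hval, Fin.tail_cons, Fin.cons_zero] at h0 ht
    have hm := hmem (v 0) (Fin.tail v)
    exact ⟨v, ⟨(inner_gibbsSection_lt hV hc hn u hm).lt_iff_lt.1 h0,
      (inner_gibbsSection_lt hV hc hn u hm).lt_iff_lt.1 ht⟩, rfl⟩

theorem integrableOn_inner_gibbsSection (hV : ∀ j, (V j).Nonempty) (hc : ∀ j, 0 ≤ c j)
    (hn : Nondeg V c b) (u e : E) :
    IntegrableOn (fun x => (inner ℝ e (gibbsSection V c b u x) : ℝ))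
      (interior (coords b '' hullComb V c)) :=
  (integrableOn_gibbsSection hV hc hn u).const_inner e

theorem integral_inner_gibbsSection [CompleteSpace E] (hV : ∀ j, (V j).Nonempty)
    (hc : ∀ j, 0 ≤ c j) (hn : Nondeg V c b) (u e : E) :
    ∫ x in interior (coords b '' hullComb V c), (inner ℝ e (gibbsSection V c b u x) : ℝ) =
      inner ℝ e (gibbsIntegral V c b u) := by
  rw [← integral_gibbsSection hV hc hn u, integral_inner (integrableOn_gibbsSection hV hc hn u)]

/-- The increment of the smoothed optimal value is the integral of a Jacobian determinant in one
dimension more. -/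
theorem inner_gibbsIntegral_sub [CompleteSpace E] (hV : ∀ j, (V j).Nonempty) (hc : ∀ j, 0 ≤ c j)
    (b : Fin l → E) (u e : E) {t : ℝ} (ht : 0 < t) :
    inner ℝ e (gibbsIntegral V c b (u + t • e)) - inner ℝ e (gibbsIntegral V c b u) =
      ∫ v in {v : Fin (l + 1) → ℝ | 0 < v 0 ∧ v 0 < t},
        (jac V c (Fin.cons e b : Fin (l + 1) → E)
          (u + embed (Fin.cons e b : Fin (l + 1) → E) v)).det := by
  classical
  by_cases hn' : Nondeg V c (Fin.cons e b : Fin (l + 1) → E)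
  swap
  · simp_rw [det_jac_eq_zero hn']
    rw [integral_zero]
    by_cases hn : Nondeg V c b
    · rw [gibbsIntegral_add_smul_of_degenerate hn hn', sub_self]
    · rw [gibbsIntegral_eq_zero hn, gibbsIntegral_eq_zero hn, sub_self]
  have hn := hn'.of_cons
  set Ω := interior (coords b '' hullComb V c)
  have hS : MeasurableSet {v : Fin (l + 1) → ℝ | 0 < v 0 ∧ v 0 < t} :=
    ((isOpen_lt continuous_const (continuous_apply 0)).inter
      (isOpen_lt (continuous_apply 0) continuous_const)).measurableSet
  have h1 := integral_image_eq_integral_abs_det_fderiv_smul volume hS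
    (fun v _ => (hasFDerivAt_gradMap (c := c) (b := (Fin.cons e b : Fin (l + 1) → E))
      hV u v).hasFDerivWithinAt) (gradMap_injective hV hc hn' u).injOn fun _ => (1 : ℝ)
  simp_rw [abs_of_nonneg (det_jac_nonneg hV hc _), smul_eq_mul, mul_one] at h1
  -- The integral of the Jacobian is the volume of the image of the slab, that is, of the region
  -- between two graphs.
  rw [← h1, setIntegral_const, smul_eq_mul, mul_one, gradMap_cons_image_slab hV hc hn']
  let φ : (Fin (l + 1) → ℝ) ≃ᵐ (Fin l → ℝ) × ℝ :=
    (MeasurableEquiv.piFinSuccAbove (fun _ => ℝ) 0).trans MeasurableEquiv.prodComm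
  have hφ : MeasurePreserving φ volume (volume.prod volume) :=
    Measure.measurePreserving_swap.comp (volume_preserving_piFinSuccAbove (fun _ => ℝ) 0)
  let A := regionBetween (fun x => (inner ℝ e (gibbsSection V c b u x) : ℝ))
    (fun x => inner ℝ e (gibbsSection V c b (u + t • e) x)) Ω
  have hpre : {x : Fin (l + 1) → ℝ | ((Fin.tail x, x 0) : (Fin l → ℝ) × ℝ) ∈ A} = φ ⁻¹' A := rfl
  have hi0 := integrableOn_inner_gibbsSection hV hc hn u e
  have hit := integrableOn_inner_gibbsSection hV hc hn (u + t • e) e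
  have hle : ∀ x ∈ Ω, (inner ℝ e (gibbsSection V c b u x) : ℝ) ≤
      inner ℝ e (gibbsSection V c b (u + t • e) x) := by
    intro x hx
    have := (inner_gibbsSection_lt hV hc hn' u hx ht).le
    simpa using this
  have hvol := volume_regionBetween_eq_integral hi0 hit isOpen_interior.measurableSet hle
  rw [hpre, measureReal_def, hφ.measure_preimage_equiv, hvol, ENNReal.toReal_ofReal]
  · simp only [Pi.sub_apply]
    rw [integral_sub hit hi0, integral_inner_gibbsSection hV hc hn,
      integral_inner_gibbsSection hV hc hn]
  · exact setIntegral_nonneg isOpen_interior.measurableSet fun x hx => sub_nonneg.2 (hle x hx)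

end Monotone

/-! ### From Gibbs integrals to the fiber polytope. -/

section Fiber

variable {n l : ℕ} (ψ : EuclideanSpace ℝ (Fin n) →ₗ[ℝ] EuclideanSpace ℝ (Fin l))

/-- The vectors representing the coordinates of a linear map. -/
noncomputable def rows (i : Fin l) : EuclideanSpace ℝ (Fin n) :=
  LinearMap.adjoint ψ (EuclideanSpace.single i 1)

theorem coords_rows (y : EuclideanSpace ℝ (Fin n)) :
    coords (rows ψ) y = WithLp.ofLp (ψ y) := by
  funext i
  rw [coords_apply, rows, LinearMap.adjoint_inner_left, EuclideanSpace.inner_single_left]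
  simp

theorem image_eq_preimage_ofLp (P : Set (EuclideanSpace ℝ (Fin n))) :
    ψ '' P = WithLp.ofLp ⁻¹' (coords (rows ψ) '' P) := by
  ext x
  constructor
  · rintro ⟨y, hy, rfl⟩
    exact ⟨y, hy, coords_rows ψ y⟩
  · rintro ⟨y, hy, h⟩
    rw [coords_rows] at h
    exact ⟨y, hy, WithLp.ofLp_injective 2 h⟩

/-- Transfers the integral to plain coordinate space, where the gradient maps and their determinants
live. -/
theorem mem_fiberIntegral_iff (P : Set (EuclideanSpace ℝ (Fin n)))
    (y : EuclideanSpace ℝ (Fin n)) :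
    y ∈ fiberIntegral ψ P ↔ ∃ γ : (Fin l → ℝ) → EuclideanSpace ℝ (Fin n),
      IntegrableOn γ (coords (rows ψ) '' P) ∧
      (∀ x ∈ coords (rows ψ) '' P, γ x ∈ P ∧ coords (rows ψ) (γ x) = x) ∧
      y = ∫ x in coords (rows ψ) '' P, γ x := by
  have hmp := EuclideanSpace.volume_preserving_symm_measurableEquiv_toLp (Fin l)
  have hemb := (MeasurableEquiv.toLp 2 (Fin l → ℝ)).symm.measurableEmbedding
  have hco : ⇑(MeasurableEquiv.toLp 2 (Fin l → ℝ)).symm = WithLp.ofLp := rfl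
  rw [hco] at hmp hemb
  constructor
  · rintro ⟨γ, hi, hs, rfl⟩
    have hγ : γ = (fun x => γ (WithLp.toLp 2 x)) ∘ WithLp.ofLp := rfl
    refine ⟨fun x => γ (WithLp.toLp 2 x), ?_, ?_, ?_⟩
    · rw [hγ, image_eq_preimage_ofLp, hmp.integrableOn_comp_preimage hemb] at hi
      exact hi
    · intro x hx
      have h := hs (WithLp.toLp 2 x) (by rw [image_eq_preimage_ofLp]; exact hx)
      refine ⟨h.1, ?_⟩
      rw [coords_rows, h.2]
    · rw [← hmp.setIntegral_preimage_emb hemb, ← image_eq_preimage_ofLp]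
  · rintro ⟨γ, hi, hs, rfl⟩
    refine ⟨γ ∘ WithLp.ofLp, ?_, ?_, ?_⟩
    · rw [image_eq_preimage_ofLp, hmp.integrableOn_comp_preimage hemb]
      exact hi
    · intro x hx
      rw [image_eq_preimage_ofLp] at hx
      have h := hs _ hx
      refine ⟨h.1, WithLp.ofLp_injective 2 ?_⟩
      rw [← coords_rows]
      exact h.2
    · rw [image_eq_preimage_ofLp]
      exact (hmp.setIntegral_preimage_emb hemb γ _).symm

variable {ψ} {J : Type*} [Fintype J] {V : J → Finset (EuclideanSpace ℝ (Fin n))} {c : J → ℝ}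

theorem interior_image_ae_eq (hV : ∀ j, (V j).Nonempty) {ι : Type*} [Fintype ι]
    (b : ι → EuclideanSpace ℝ (Fin n)) :
    (interior (coords b '' hullComb V c) : Set (ι → ℝ)) =ᵐ[volume] coords b '' hullComb V c :=
  interior_ae_eq_of_null_frontier (((isPolytope_hullComb hV c).convex.linear_image
    (coords b).toLinearMap).addHaar_frontier volume)

theorem eq_zero_of_mem_fiberIntegral (hn : ¬ Nondeg V c (rows ψ)) {y : EuclideanSpace ℝ (Fin n)}
    (hy : y ∈ fiberIntegral ψ (hullComb V c)) : y = 0 := by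
  obtain ⟨γ, -, -, rfl⟩ := (mem_fiberIntegral_iff ψ _ y).1 hy
  exact setIntegral_measure_zero _ (volume_image_eq_zero hn)

theorem gibbsIntegral_mem_fiberIntegral (hV : ∀ j, (V j).Nonempty) (hc : ∀ j, 0 ≤ c j)
    (u : EuclideanSpace ℝ (Fin n)) :
    gibbsIntegral V c (rows ψ) u ∈ fiberIntegral ψ (hullComb V c) := by
  classical
  by_cases hn : Nondeg V c (rows ψ)
  swap
  · obtain ⟨y, hy⟩ := (isPolytope_fiberIntegral ψ (isPolytope_hullComb hV c)).nonempty
    rw [gibbsIntegral_eq_zero hn, ← eq_zero_of_mem_fiberIntegral hn hy]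
    exact hy
  rw [mem_fiberIntegral_iff]
  set Q := coords (rows ψ) '' hullComb V c with hQ
  have hsec : ∀ x ∈ Q, ∃ y ∈ hullComb V c, coords (rows ψ) y = x := fun x hx => hx
  choose! s hs1 hs2 using hsec
  -- A section is needed on all of `Q`. The boundary of the convex set `Q` is null, so an arbitrary
  -- selection there leaves the integral unchanged.
  let γ : (Fin l → ℝ) → EuclideanSpace ℝ (Fin n) := fun x =>
    if x ∈ interior Q then gibbsSection V c (rows ψ) u x else s x
  have hγ : Set.EqOn γ (gibbsSection V c (rows ψ) u) (interior Q) := fun x hx => if_pos hx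
  have hae := interior_image_ae_eq (c := c) hV (rows ψ)
  refine ⟨γ, ?_, fun x hx => ?_, ?_⟩
  · refine IntegrableOn.congr_set_ae ?_ hae.symm
    exact (integrableOn_congr_fun hγ isOpen_interior.measurableSet).2
      (integrableOn_gibbsSection hV hc hn u)
  · by_cases hx' : x ∈ interior Q
    · rw [hγ hx']
      exact ⟨gibbsSection_mem hV u x, coords_gibbsSection hV hc u hx'⟩
    · simp only [γ, if_neg hx']
      exact ⟨hs1 x hx, hs2 x hx⟩
  · rw [← setIntegral_congr_set hae, setIntegral_congr_fun isOpen_interior.measurableSet hγ,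
      integral_gibbsSection hV hc hn]

/-- The smoothed optimal section is nearly optimal in a direction that dominates. -/
theorem exists_supp_fiberIntegral_le (hV : ∀ j, (V j).Nonempty) (hc : ∀ j, 0 ≤ c j)
    (u w : EuclideanSpace ℝ (Fin n)) : ∃ K : ℝ, ∀ t : ℝ, 0 < t →
      supp (fiberIntegral ψ (hullComb V c)) w ≤
        inner ℝ w (gibbsIntegral V c (rows ψ) (u + t • w)) + K / t := by
  have hP := isPolytope_fiberIntegral ψ (isPolytope_hullComb hV c)
  by_cases hn : Nondeg V c (rows ψ)
  swap
  · refine ⟨0, fun t _ => supp_le hP.nonempty fun y hy => ?_⟩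
    rw [eq_zero_of_mem_fiberIntegral hn hy, gibbsIntegral_eq_zero hn]
    simp
  set Ω := interior (coords (rows ψ) '' hullComb V c) with hΩ
  have hΩtop : volume Ω ≠ ⊤ := (volume_interior_lt_top hV c _).ne
  obtain ⟨C, hC⟩ := (isPolytope_hullComb hV c).isCompact.isBounded.exists_norm_le
  -- The entropy gap plus the cost of dropping `⟪u, ·⟫` at both the competitor and the Gibbs
  -- section; dividing by `t` isolates direction `w`.
  let N : ℝ := ∑ j, c j * (V j).card + 2 * (‖u‖ * C)
  refine ⟨volume.real Ω * N, fun t ht => supp_le hP.nonempty fun y hy => ?_⟩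
  obtain ⟨δ, hi, hs, rfl⟩ := (mem_fiberIntegral_iff ψ _ y).1 hy
  have hae := interior_image_ae_eq (c := c) hV (rows ψ)
  rw [← setIntegral_congr_set hae]
  have hi' : IntegrableOn δ Ω := hi.mono_set interior_subset
  have hg := integrableOn_inner_gibbsSection hV hc hn (u + t • w) w
  rw [← integral_inner hi', ← integral_inner_gibbsSection hV hc hn (u + t • w) w]
  have hconst : volume.real Ω * N / t = ∫ _ in Ω, N / t := by
    rw [setIntegral_const, smul_eq_mul, mul_div_assoc]
  have hcI : IntegrableOn (fun _ : Fin l → ℝ => N / t) Ω := integrableOn_const hΩtop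
  rw [hconst, ← integral_add hg hcI]
  refine setIntegral_mono_on (hi'.const_inner w) (hg.add hcI) isOpen_interior.measurableSet
    fun x hx => ?_
  have h1 := inner_le_inner_gibbsSection hV hc (u + t • w) hx (hs x (interior_subset hx)).1
    (hs x (interior_subset hx)).2
  set γ := gibbsSection V c (rows ψ) (u + t • w) x
  have hb : ∀ z ∈ hullComb V c, |inner ℝ u z| ≤ ‖u‖ * C := fun z hz =>
    (abs_real_inner_le_norm u z).trans (mul_le_mul_of_nonneg_left (hC z hz) (norm_nonneg u))
  have h2 := (abs_le.1 (hb _ (hs x (interior_subset hx)).1)).1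
  have h3 := (abs_le.1 (hb γ (gibbsSection_mem hV _ x))).2
  rw [inner_add_left, inner_add_left, real_inner_smul_left, real_inner_smul_left] at h1
  have h4 : t * inner ℝ w (δ x) ≤ t * (inner ℝ w γ + N / t) := by
    rw [mul_add, mul_div_cancel₀ _ ht.ne']
    simp only [N]
    linarith
  exact le_of_mul_le_mul_left h4 ht

theorem tendsto_inner_gibbsIntegral (hV : ∀ j, (V j).Nonempty) (hc : ∀ j, 0 ≤ c j)
    (u w : EuclideanSpace ℝ (Fin n)) :
    Tendsto (fun t : ℝ => (inner ℝ w (gibbsIntegral V c (rows ψ) (u + t • w)) : ℝ)) atTop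
      (𝓝 (supp (fiberIntegral ψ (hullComb V c)) w)) := by
  obtain ⟨K, hK⟩ := exists_supp_fiberIntegral_le (ψ := ψ) hV hc u w
  have hlim : Tendsto (fun t : ℝ => supp (fiberIntegral ψ (hullComb V c)) w - K / t) atTop
      (𝓝 (supp (fiberIntegral ψ (hullComb V c)) w)) := by
    simpa using (tendsto_const_nhds (x := K).div_atTop tendsto_id).const_sub
      (supp (fiberIntegral ψ (hullComb V c)) w)
  refine tendsto_of_tendsto_of_tendsto_of_le_of_le' hlim tendsto_const_nhds ?_ ?_
  · filter_upwards [eventually_gt_atTop 0] with t ht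
    linarith [hK t ht]
  · exact Eventually.of_forall fun t => inner_le_supp
      (isPolytope_fiberIntegral ψ (isPolytope_hullComb hV c)).isCompact w
      (gibbsIntegral_mem_fiberIntegral hV hc _)

end Fiber

/-! ### The coefficients are support functions of polytopes. -/

section Expansion

variable {n l : ℕ} {ψ : EuclideanSpace ℝ (Fin n) →ₗ[ℝ] EuclideanSpace ℝ (Fin l)}
  {J : Type*} [Fintype J] [DecidableEq J] {V : J → Finset (EuclideanSpace ℝ (Fin n))}

/-- The support function of the Minkowski integral of `∑ j, c j • conv (V j)` is a polynomial in
`c` whose coefficients are support functions of polytopes. -/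
theorem exists_polytope_coefficients (hV : ∀ j, (V j).Nonempty) :
    ∃ M : (J → ℕ) → Polytope n, ∀ c : J → ℝ, (∀ j, 0 ≤ c j) → ∀ w,
      supp (fiberIntegral ψ (hullComb V c)) w =
        homPoly (l + 1) (fun i => supp (M i).1 w) c := by
  classical
  let D := Finset.piAntidiag (Finset.univ : Finset J) (l + 1)
  let h : (J → ℝ) → EuclideanSpace ℝ (Fin n) → ℝ := fun c w =>
    supp (fiberIntegral ψ (hullComb V c)) w
  let Y : (J → ℝ) → EuclideanSpace ℝ (Fin n) → EuclideanSpace ℝ (Fin n) := fun c u =>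
    gibbsIntegral V c (rows ψ) u
  have hpol : ∀ c, IsPolytope (fiberIntegral ψ (hullComb V c)) := fun c =>
    isPolytope_fiberIntegral ψ (isPolytope_hullComb hV c)
  have hex := fun (i : J → ℕ) (hi : i ∈ D) => exists_coeff_extraction (l + 1) hi
  choose! s r hs hr using hex
  -- `T i` reads off the `i`-th coefficient from finitely many values at positive `c`. Being a
  -- finite sum, it commutes with limits in `t`.
  let T : (J → ℕ) → ((J → ℝ) → ℝ) → ℝ := fun i f => ∑ c ∈ s i, r i c * f c
  have hTY : ∀ u w, ∀ c : J → ℝ, (∀ j, 0 ≤ c j) →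
      (inner ℝ w (Y c u) : ℝ) = homPoly (l + 1) (fun i => T i fun c => inner ℝ w (Y c u)) c := by
    intro u w c hc
    obtain ⟨a, ha⟩ := inner_gibbsIntegral_eq_homPoly hV (rows ψ) u w
    rw [ha c hc]
    refine Finset.sum_congr rfl fun i hi => ?_
    rw [← hr i hi a]
    congr 1
    exact Finset.sum_congr rfl fun c hc' =>
      congrArg (r i c * ·) (ha c fun j => (hs i hi c hc' j).le).symm
  have hTlim : ∀ u w, ∀ i ∈ D, Tendsto (fun t : ℝ => T i fun c => inner ℝ w (Y c (u + t • w)))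
      atTop (𝓝 (T i fun c => h c w)) := by
    intro u w i hi
    refine tendsto_finsetSum _ fun c hc => Tendsto.const_mul _ ?_
    exact tendsto_inner_gibbsIntegral hV (fun j => (hs i hi c hc j).le) u w
  -- The difference is the `i`-th coefficient of an integrated Jacobian in one dimension more, hence
  -- nonnegative even though the weights `r i c` may have either sign.
  have hmono : ∀ u e, ∀ i ∈ D, ∀ t : ℝ, 0 < t →
      (T i fun c => inner ℝ e (Y c u)) ≤ T i fun c => inner ℝ e (Y c (u + t • e)) := by
    intro u e i hi t ht
    obtain ⟨a, ha0, ha⟩ := setIntegral_det_jac_eq_homPoly hV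
      (Fin.cons e (rows ψ) : Fin (l + 1) → EuclideanSpace ℝ (Fin n)) u
      {v | 0 < v 0 ∧ v 0 < t}
    rw [Fintype.card_fin] at ha
    have hdiff : (T i fun c => inner ℝ e (Y c (u + t • e))) - (T i fun c => inner ℝ e (Y c u)) =
        a i := by
      rw [← hr i hi a, ← Finset.sum_sub_distrib]
      refine Finset.sum_congr rfl fun c hc => ?_
      rw [← mul_sub, ← ha c, ← inner_gibbsIntegral_sub hV (fun j => (hs i hi c hc j).le) _ u e ht]
    linarith [ha0 i]
  have hle : ∀ u w, ∀ i ∈ D, (T i fun c => inner ℝ w (Y c u)) ≤ T i fun c => h c w := by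
    intro u w i hi
    refine ge_of_tendsto (hTlim u w i hi) ?_
    filter_upwards [eventually_gt_atTop 0] with t ht using hmono u w i hi t ht
  have hM : ∀ i, ∃ M : Polytope n, i ∈ D → ∀ w, supp M.1 w = T i fun c => h c w := by
    intro i
    by_cases hi : i ∈ D
    swap
    · exact ⟨0, fun hi' => absurd hi' hi⟩
    choose F hF using fun c => exists_finset_supp (hpol c)
    obtain ⟨M, hMp, hMs⟩ := exists_supp_eq_of_sublinear (fun w => T i fun c => h c w)
      (continuous_finsetSum _ fun c _ => (continuous_supp (hpol c)).const_mul _)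
      (fun u w => by
        -- Before the limit the expression is additive in the direction at a fixed base point, and
        -- `hle` bounds each summand by its own limit.
        refine le_of_tendsto (hTlim 0 (u + w) i hi) (Eventually.of_forall fun t => ?_)
        have hsplit : (T i fun c => inner ℝ (u + w) (Y c (0 + t • (u + w)))) =
            (T i fun c => inner ℝ u (Y c (0 + t • (u + w)))) +
              T i fun c => inner ℝ w (Y c (0 + t • (u + w))) := by
          simp only [T, inner_add_left, mul_add, Finset.sum_add_distrib]
        rw [hsplit]
        exact add_le_add (hle _ u i hi) (hle _ w i hi))
      (fun t ht u => by
        simp only [T, h]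
        rw [Finset.mul_sum]
        exact Finset.sum_congr rfl fun c _ => by
          rw [supp_arg_smul _ ht]
          ring)
      -- All signed combinations of one candidate point for each sampled `c`.
      (∑ c ∈ s i, (F c).image fun a => r i c • a)
      (fun w => by
        choose g hg using fun c => hF c w
        refine ⟨∑ c ∈ s i, r i c • g c, ?_, ?_⟩
        · rw [← Finset.mem_coe, Finset.coe_sum]
          exact Set.finsetSum_mem_finsetSum _ _ _ fun c _ =>
            Finset.mem_coe.2 (Finset.mem_image_of_mem _ (hg c).1)
        · simp only [T, h, inner_sum, inner_smul_right]
          exact Finset.sum_congr rfl fun c _ => by rw [(hg c).2])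
    exact ⟨⟨M, hMp⟩, fun _ w => congrFun hMs w⟩
  choose M hM using hM
  refine ⟨M, fun c hc w => ?_⟩
  -- The smoothed value converges to the support function and, coefficient by coefficient, to the
  -- polynomial built from `M`.
  refine tendsto_nhds_unique (tendsto_inner_gibbsIntegral hV hc 0 w) ?_
  simp_rw [show ∀ u, (inner ℝ w (gibbsIntegral V c (rows ψ) u) : ℝ) = _ from
    fun u => hTY u w c hc]
  refine tendsto_finsetSum _ fun i hi => Tendsto.const_mul _ ?_
  dsimp only
  rw [hM i hi w]
  exact hTlim 0 w i hi

end Expansion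

/-! ### Existence and uniqueness of the expansion. -/

section Main

variable {n l : ℕ}

theorem zero_smul_polytope (P : Polytope n) : (0 : ℝ) • P = 0 :=
  Subtype.ext (Set.zero_smul_set P.2.nonempty)

theorem one_smul_polytope (P : Polytope n) : (1 : ℝ) • P = P :=
  Subtype.ext (one_smul ℝ P.1)

theorem suppHom_homPoly {J : Type*} [Fintype J] [DecidableEq J] (d : ℕ)
    (M : (J → ℕ) → Polytope n) {c : J → ℝ} (hc : ∀ j, 0 ≤ c j) (w : EuclideanSpace ℝ (Fin n)) :
    suppHom n (∑ i ∈ Finset.piAntidiag Finset.univ d, (∏ j, c j ^ i j) • M i) w =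
      homPoly d (fun i => supp (M i).1 w) c := by
  rw [map_sum, Finset.sum_apply]
  refine Finset.sum_congr rfl fun i _ => ?_
  rw [suppHom_smul (Finset.prod_nonneg fun j _ => pow_nonneg (hc j) _)]
  rfl

/-- Zero coefficients are allowed, so that the expansion can be evaluated at indicator vectors of
subsets. -/
theorem exists_fiber_expansion {J : Type*} [Fintype J] [DecidableEq J]
    (ψ : EuclideanSpace ℝ (Fin n) →ₗ[ℝ] EuclideanSpace ℝ (Fin l)) (P : J → Polytope n) :
    ∃ M : (J → ℕ) → Polytope n, ∀ c : J → ℝ, (∀ j, 0 ≤ c j) →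
      fiberPolytope ψ (∑ j, c j • P j) =
        ∑ i ∈ Finset.piAntidiag Finset.univ (l + 1), (∏ j, c j ^ i j) • M i := by
  choose V hV hP using fun j => (P j).2
  obtain ⟨M, hM⟩ := exists_polytope_coefficients (ψ := ψ) hV
  refine ⟨M, fun c hc => suppHom_injective n (funext fun w => ?_)⟩
  rw [suppHom_homPoly _ _ hc, ← hM c hc w]
  have hsum : (∑ j, c j • P j).1 = hullComb V c := by
    rw [AddSubmonoid.coe_finsetSum, hullComb]
    exact Finset.sum_congr rfl fun j _ => congrArg (c j • ·) (hP j)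
  rw [← hsum]
  rfl

theorem IsFiberExpansion.coeff_unique {r : ℕ}
    {ψ : EuclideanSpace ℝ (Fin n) →ₗ[ℝ] EuclideanSpace ℝ (Fin l)} {P : Fin r → Polytope n}
    {M N : (Fin r → ℕ) → Polytope n} (hM : IsFiberExpansion ψ P M) (hN : IsFiberExpansion ψ P N)
    {i : Fin r → ℕ} (hi : i ∈ Finset.piAntidiag Finset.univ (l + 1)) : M i = N i := by
  refine suppHom_injective n (funext fun w => ?_)
  refine homPoly_coeff_unique (a := fun i => supp (M i).1 w) (b := fun i => supp (N i).1 w)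
    (fun c hc => ?_) hi
  rw [← suppHom_homPoly _ _ fun j => (hc j).le, ← suppHom_homPoly _ _ fun j => (hc j).le,
    ← hM c hc, ← hN c hc]

theorem one_mem_piAntidiag (r : ℕ) :
    (fun _ => 1 : Fin r → ℕ) ∈ Finset.piAntidiag Finset.univ r := by
  simp [Finset.mem_piAntidiag]

end Main

end FiberPoly

theorem theorem2p3 (n l : ℕ)
    (ψ : EuclideanSpace ℝ (Fin n) →ₗ[ℝ] EuclideanSpace ℝ (Fin l))
    (P : Fin (l + 1) → FiberPoly.Polytope n) :
    (∃! M : FiberPoly.Polytope n, FiberPoly.IsMixedFiberPolytope ψ P M) ∧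
      ∀ M : FiberPoly.Polytope n, FiberPoly.IsMixedFiberPolytope ψ P M →
        M.toVirtual =
          ∑ k ∈ Finset.Icc 1 (l + 1), (-1 : ℤ) ^ (l + 1 + k) •
            ∑ I ∈ Finset.powersetCard k (Finset.univ : Finset (Fin (l + 1))),
              (FiberPoly.fiberPolytope ψ (∑ i ∈ I, P i)).toVirtual := by
  obtain ⟨M, hM⟩ := FiberPoly.exists_fiber_expansion ψ P
  have hMe : FiberPoly.IsFiberExpansion ψ P M := fun c hc => hM c fun j => (hc j).le
  have huniq : ∀ M', FiberPoly.IsMixedFiberPolytope ψ P M' → M' = M fun _ => 1 := by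
    rintro _ ⟨N, hN, rfl⟩
    exact hN.coeff_unique hMe (FiberPoly.one_mem_piAntidiag _)
  refine ⟨⟨M fun _ => 1, ⟨M, hMe, rfl⟩, huniq⟩, fun M' hM' => ?_⟩
  rw [huniq M' hM']
  apply FiberPoly.virtual_ext
  simp only [map_sum, map_zsmul, FiberPoly.lift_suppHom_toVirtual]
  funext w
  -- The partial sum over `I` is the Minkowski combination at the indicator vector of `I`.
  have hval : ∀ I : Finset (Fin (l + 1)),
      FiberPoly.suppHom n (FiberPoly.fiberPolytope ψ (∑ i ∈ I, P i)) w =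
        FiberPoly.homPoly (l + 1) (fun i => FiberPoly.supp (M i).1 w)
          (fun j => if j ∈ I then 1 else 0) := by
    intro I
    have hc : ∀ j, (0 : ℝ) ≤ if j ∈ I then 1 else 0 := fun j => by split_ifs <;> norm_num
    rw [← FiberPoly.suppHom_homPoly _ _ hc, ← hM _ hc]
    have hsum : ∑ i ∈ I, P i = ∑ j, if j ∈ I then P j else 0 := by
      rw [Finset.sum_ite_mem, Finset.univ_inter]
    rw [hsum]
    have hsmul : ∑ j, (if j ∈ I then (1 : ℝ) else 0) • P j = ∑ j, if j ∈ I then P j else 0 := by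
      refine Finset.sum_congr rfl fun j _ => ?_
      split_ifs
      · rw [FiberPoly.one_smul_polytope]
      · rw [FiberPoly.zero_smul_polytope]
    rw [hsmul]
  have hmain := FiberPoly.sum_powerset_homPoly (J := Fin (l + 1))
    fun i => FiberPoly.supp (M i).1 w
  simp_rw [Fintype.card_fin] at hmain
  -- Subsets are sorted by size. The empty set contributes nothing since the degree `l + 1` is
  -- positive, so the sum starts at `k = 1`.
  rw [Finset.sum_powerset, Finset.card_univ, Fintype.card_fin, Finset.sum_range_succ',
    Finset.powersetCard_zero, Finset.sum_singleton, FiberPoly.homPoly_succ_zero (by simp),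
    mul_zero, add_zero, Finset.range_eq_Ico, Finset.sum_Ico_add' (fun k =>
      ∑ I ∈ Finset.powersetCard k (Finset.univ : Finset (Fin (l + 1))),
        (-1 : ℝ) ^ (l + 1 + I.card) * FiberPoly.homPoly (l + 1)
          (fun i => FiberPoly.supp (M i).1 w) (fun j => if j ∈ I then 1 else 0)) 0 (l + 1) 1] at hmain
  have hIcc : Finset.Icc 1 (l + 1) = Finset.Ico (0 + 1) (l + 1 + 1) := rfl
  rw [FiberPoly.suppHom_apply, ← hmain, hIcc, Finset.sum_apply]
  refine Finset.sum_congr rfl fun k _ => ?_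
  rw [Pi.smul_apply, Finset.sum_apply, zsmul_eq_mul, Finset.mul_sum]
  refine Finset.sum_congr rfl fun I hI => ?_
  rw [hval, (Finset.mem_powersetCard.1 hI).2]
  push_cast
  rfl
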